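/- **Setting.** Fix $T\in[0,\infty)$ and a probability space $(\Omega,\mathcal F,P)$ with a filtration $(\mathcal F_t)_{0\le t\le T}$ satisfying the usual conditions (right continuity; $\mathcal F_0$ contains all null sets), with $\mathcal F_T=\mathcal F$ and with every event of $\mathcal F_0$ having probability $0$ or $1$. Let $T_0$ be the set of stopping times with values in $[0,T]$ and, for $S\in T_0$, let $T_S=\{\theta\in T_0:\ S\le\theta \text{ a.s.}\}$. The essential supremum of a family of random variables is its least almost sure upper bound. A family $\{\psi(\theta,S):\theta,S\in T_0\}$ of finite random variables is *biadmissible* if each $\psi(\theta,S)$ is $\mathcal F_{\theta\vee S}$-measurable and a.s. nonnegative, and $\psi(\theta,S)=\psi(\theta',S')$ a.s. on $\{\theta=\theta'\}\cap\{S=S'\}$ for all $\theta,\theta',S,S'\in T_0$. It is *uniformly right* (resp. *left*) *continuous in expectation along stopping times* if for every $S\in T_0$ and every sequence $(S_n)$ in $T_0$ which a.s. is nonincreasing (resp. nondecreasing) and converges to $S$, $$\lim_{n}E\Big[\operatorname*{ess\,sup}_{\theta\in T_0}|\psi(\theta,S)-\psi(\theta,S_n)|\Big]=0\quad\text{and}\quad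 \lim_{n}E\Big[\operatorname*{ess\,sup}_{\theta\in T_0}|\psi(S,\theta)-\psi(S_n,\theta)|\Big]=0 .$$ **Theorem.** Let $\psi$ be a biadmissible family which is uniformly right and left continuous in expectation along stopping times, and suppose that $E[\operatorname{ess\,sup}_{\theta,S\in T_0}\psi(\theta,S)^p]<\infty$ for some $p>1$. For $\theta\in T_0$ put $$u_1(\theta)=\operatorname*{ess\,sup}_{\tau\in T_\theta}E[\psi(\tau,\theta)\mid\mathcal F_\theta],\qquad u_2(\theta)=\operatorname*{ess\,sup}_{\tau\in T_\theta}E[\psi(\theta,\tau)\mid\mathcal F_\theta],\qquad \phi(\theta)=\max(u_1(\theta),u_2(\theta)).$$ Then for every $S\in T_0$ there is $\theta^*\in T_S$ that is optimal for the reduced problem, i.e. $\operatorname{ess\,sup}_{\theta\in T_S}E[\phi(\theta)\mid\mathcal F_S]=E[\phi(\theta^*)\mid\mathcal F_S]$ a.s., and there are $\theta_1^*,\theta_2^*\in T_{\theta^*}$ that are optimal for the two inner problems, i.e. $u_1(\theta^*)=E[\psi(\theta_1^*,\theta^*)\mid\mathcal F_{\theta^*}]$ and $u_2(\theta^*)=E[\psi(\theta^*,\theta_2^*)\mid\mathcal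 F_{\theta^*}]$ a.s., and there are stopping times $\tau_1^*,\tau_2^*\in T_S$ such that a.s. $$(\tau_1^*,\tau_2^*)=(\theta^*,\theta_2^*)\ \text{ on } \{u_1(\theta^*)\le u_2(\theta^*)\},\qquad (\tau_1^*,\tau_2^*)=(\theta_1^*,\theta^*)\ \text{ on } \{u_1(\theta^*)>u_2(\theta^*)\},$$ and the pair $(\tau_1^*,\tau_2^*)$ attains the double stopping value: $$v(S)=\operatorname*{ess\,sup}_{\tau_1,\tau_2\in T_S}E[\psi(\tau_1,\tau_2)\mid\mathcal F_S]=E[\psi(\tau_1^*,\tau_2^*)\mid\mathcal F_S]\quad\text{a.s.}$$ -/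

import Mathlib

open MeasureTheory Filter Topology
open scoped ENNReal

namespace DoubleStopping

/-- `g` is (a version of) the essential supremum of the family of random variables `f i`: the least
random variable, up to almost sure equality, that almost surely dominates each `f i`. -/
def IsEssSup {Ω ι β : Type*} [MeasurableSpace Ω] [MeasurableSpace β] [Preorder β]
    (μ : Measure Ω) (f : ι → Ω → β) (g : Ω → β) : Prop :=
  Measurable g ∧ (∀ i, f i ≤ᵐ[μ] g) ∧
    ∀ h : Ω → β, Measurable h → (∀ i, f i ≤ᵐ[μ] h) → g ≤ᵐ[μ] h

/-- The standing assumptions on the filtration `(𝓕 t)`, `0 ≤ t ≤ T`: the usual conditions (right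
continuity, completeness, all null sets belong to `𝓕 0`), `𝓕 T` is the whole σ-algebra, and `𝓕 0`
contains only events of probability `0` or `1`. -/
structure IsStandardFiltration {Ω : Type*} {m : MeasurableSpace Ω} (μ : Measure Ω) {T : ℝ}
    (hT : 0 ≤ T) (𝓕 : Filtration (Set.Icc (0 : ℝ) T) m) : Prop where
  right_continuous : 𝓕.IsRightContinuous
  null_sets : ∀ s : Set Ω, μ s = 0 → MeasurableSet[𝓕 ⟨0, Set.left_mem_Icc.2 hT⟩] s
  terminal : 𝓕 ⟨T, Set.right_mem_Icc.2 hT⟩ = m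
  zero_one : ∀ s : Set Ω, MeasurableSet[𝓕 ⟨0, Set.left_mem_Icc.2 hT⟩] s → μ s = 0 ∨ μ s = 1

section

variable {Ω : Type*} {m : MeasurableSpace Ω} {T : ℝ}

/-- The set of stopping times with values in `[0, T]`. -/
def StopTime (𝓕 : Filtration (Set.Icc (0 : ℝ) T) m) : Type _ :=
  {τ : Ω → Set.Icc (0 : ℝ) T //
    IsStoppingTime 𝓕 (fun ω => (τ ω : WithTop (Set.Icc (0 : ℝ) T)))}

variable {𝓕 : Filtration (Set.Icc (0 : ℝ) T) m}

instance : CoeFun (StopTime 𝓕) (fun _ => Ω → Set.Icc (0 : ℝ) T) := ⟨fun τ => τ.1⟩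

/-- The σ-algebra of events prior to `τ`. -/
abbrev StopTime.sigma (τ : StopTime 𝓕) : MeasurableSpace Ω :=
  τ.2.measurableSpace

/-- The maximum of two stopping times. -/
def StopTime.max (τ σ : StopTime 𝓕) : StopTime 𝓕 :=
  ⟨fun ω => Max.max (τ ω) (σ ω), by
    have h := τ.2.max σ.2
    simpa only [WithTop.coe_max] using h⟩

/-- The set of stopping times in `[0, T]` that are almost surely at least `S`. -/
def StopAfter (μ : Measure Ω) (S : StopTime 𝓕) : Type _ :=
  {τ : StopTime 𝓕 // ∀ᵐ ω ∂μ, S ω ≤ τ ω}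

/-- Biadmissible families `ψ(θ, S)` of nonnegative random variables indexed by pairs of stopping
times. -/
structure IsBiadmissible (μ : Measure Ω) (ψ : StopTime 𝓕 → StopTime 𝓕 → Ω → ℝ) : Prop where
  measurable : ∀ θ S, Measurable[(θ.max S).sigma] (ψ θ S)
  nonneg : ∀ θ S, ∀ᵐ ω ∂μ, 0 ≤ ψ θ S ω
  compatible : ∀ θ θ' S S' : StopTime 𝓕,
    ∀ᵐ ω ∂μ, θ ω = θ' ω → S ω = S' ω → ψ θ S ω = ψ θ' S' ω

/-- `σ n ↓ S` almost surely. -/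
def DecreasesTo (μ : Measure Ω) (σ : ℕ → StopTime 𝓕) (S : StopTime 𝓕) : Prop :=
  ∀ᵐ ω ∂μ, Antitone (fun n => σ n ω) ∧ Tendsto (fun n => σ n ω) atTop (𝓝 (S ω))

/-- `σ n ↑ S` almost surely. -/
def IncreasesTo (μ : Measure Ω) (σ : ℕ → StopTime 𝓕) (S : StopTime 𝓕) : Prop :=
  ∀ᵐ ω ∂μ, Monotone (fun n => σ n ω) ∧ Tendsto (fun n => σ n ω) atTop (𝓝 (S ω))

/-- Uniform convergence in expectation along the sequence `σ n` to `S`: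
`E[ess sup_θ |ψ(θ, S) - ψ(θ, σ n)|] → 0` and `E[ess sup_θ |ψ(S, θ) - ψ(σ n, θ)|] → 0`. -/
def UniformlyConvergesAlong (μ : Measure Ω) (ψ : StopTime 𝓕 → StopTime 𝓕 → Ω → ℝ)
    (σ : ℕ → StopTime 𝓕) (S : StopTime 𝓕) : Prop :=
  (∃ G : ℕ → Ω → ℝ≥0∞,
    (∀ n, IsEssSup μ
      (fun (θ : StopTime 𝓕) ω => ENNReal.ofReal |ψ θ S ω - ψ θ (σ n) ω|) (G n)) ∧
    Tendsto (fun n => ∫⁻ ω, G n ω ∂μ) atTop (𝓝 0)) ∧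
  (∃ G : ℕ → Ω → ℝ≥0∞,
    (∀ n, IsEssSup μ
      (fun (θ : StopTime 𝓕) ω => ENNReal.ofReal |ψ S θ ω - ψ (σ n) θ ω|) (G n)) ∧
    Tendsto (fun n => ∫⁻ ω, G n ω ∂μ) atTop (𝓝 0))

/-- Uniform right continuity in expectation along stopping times. -/
def UniformlyRightContinuous (μ : Measure Ω) (ψ : StopTime 𝓕 → StopTime 𝓕 → Ω → ℝ) : Prop :=
  ∀ (S : StopTime 𝓕) (σ : ℕ → StopTime 𝓕),
    DecreasesTo μ σ S → UniformlyConvergesAlong μ ψ σ S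

/-- Uniform left continuity in expectation along stopping times. -/
def UniformlyLeftContinuous (μ : Measure Ω) (ψ : StopTime 𝓕 → StopTime 𝓕 → Ω → ℝ) : Prop :=
  ∀ (S : StopTime 𝓕) (σ : ℕ → StopTime 𝓕),
    IncreasesTo μ σ S → UniformlyConvergesAlong μ ψ σ S

/-- `v` is (a version of) the double stopping value
`v(S) = ess sup_{τ₁, τ₂ ≥ S} E[ψ(τ₁, τ₂) | 𝓕_S]`. -/
def IsDoubleValue (μ : Measure Ω) (ψ : StopTime 𝓕 → StopTime 𝓕 → Ω → ℝ) (S : StopTime 𝓕)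
    (v : Ω → ℝ) : Prop :=
  IsEssSup μ (fun q : StopAfter μ S × StopAfter μ S => μ[ψ q.1.1 q.2.1 | S.sigma]) v

/-- `v` is (a version of) the single stopping value `ess sup_{τ ≥ S} E[φ(τ) | 𝓕_S]` of the reward
family `φ`. -/
def IsSingleValue (μ : Measure Ω) (φ : StopTime 𝓕 → Ω → ℝ) (S : StopTime 𝓕)
    (v : Ω → ℝ) : Prop :=
  IsEssSup μ (fun τ : StopAfter μ S => μ[φ τ.1 | S.sigma]) v

/-- `τ` is an optimal stopping time for the single stopping problem with reward `φ` started
at `S`. -/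
def IsOptimal (μ : Measure Ω) (φ : StopTime 𝓕 → Ω → ℝ) (S τ : StopTime 𝓕) : Prop :=
  (∀ᵐ ω ∂μ, S ω ≤ τ ω) ∧ ∃ v : Ω → ℝ, IsSingleValue μ φ S v ∧ v =ᵐ[μ] μ[φ τ | S.sigma]

end

end DoubleStopping

namespace DoubleStopping

/-! Once the earlier of two stopping times has occurred, only one decision remains. So the reward of
any pair, conditioned at `τ₁ ∧ τ₂`, is at most `φ(τ₁ ∧ τ₂)` (`condExp_le_reducedReward`), and for
every `η` equality holds for a pair made of `η` and an optimal inner time (`exists_pair`). The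
double problem therefore reduces to a single one with reward `φ`, and a maximizer `θ` of `E[φ]`
produces an optimal pair (`isDoubleValue_of_max`). The two inner problems and the reduced one are
all solved by `IsReward.exists_max`, which needs only upper semicontinuity in mean. In place of a
Snell envelope it takes a maximal stopping time beyond which the supremum can still be approached;
modularity of the expected reward under minimum and maximum shows that the supremum is attained
there. A gluing argument upgrades maximal expectation to maximal conditional expectation. It remains
to see that `φ` is such a reward. From the right, inner values are continuous in mean
(`tendsto_innerValue`), which rests on backward martingale convergence. From the left, `φ(σ n)` is
represented by its optimal pair and both times are delayed to the limit `θ`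
(`tendsto_integral_abs_sub_max`). The sequences met there are squeezed below `θ` but not monotone;
`left_snd_of_squeezed` treats them. -/

/-! ### Backward martingale convergence in L¹. -/

theorem tendsto_integral_abs_condExp_sub_of_memLp_two {Ω : Type*} {m : MeasurableSpace Ω}
    {μ : Measure Ω} [IsProbabilityMeasure μ] {G : ℕ → MeasurableSpace Ω} (hG : ∀ n, G n ≤ m)
    (hanti : Antitone G) {f : Ω → ℝ} (hf : MemLp f 2 μ) :
    ∃ z : Lp ℝ 2 μ, (∀ n, AEStronglyMeasurable[G n] z μ) ∧
      Tendsto (fun n => ∫ ω, |(μ[f | G n]) ω - z ω| ∂μ) atTop (𝓝 0) := by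
  have hfact : ∀ n, Fact (G n ≤ m) := fun n => ⟨hG n⟩
  let U : ℕ → Submodule ℝ (Lp ℝ 2 μ) := fun n => lpMeas ℝ ℝ (G n) 2 μ
  -- Conditional expectation is the projection onto `U n`. These subspaces decrease, so their
  -- complements increase, and projections onto increasing subspaces converge strongly.
  have hU : Monotone fun n => (U n)ᗮ := fun i j hij => by
    refine Submodule.orthogonal_le fun g hg => ?_
    rw [mem_lpMeas_iff_aestronglyMeasurable] at hg ⊢
    exact hg.mono (hanti hij)
  have hclosed : ∀ n, IsClosed (U n : Set (Lp ℝ 2 μ)) := fun n =>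
    isClosed_aestronglyMeasurable (hG n)
  let x : Lp ℝ 2 μ := hf.toLp f
  have hlim := Submodule.starProjection_tendsto_closure_iSup (fun n => (U n)ᗮ) hU x
  set y := (⨆ i, (U i)ᗮ).topologicalClosure.starProjection x
  have hlim' : Tendsto (fun n => (U n).starProjection x) atTop (𝓝 (x - y)) := by
    have := tendsto_const_nhds (x := x).sub hlim
    refine this.congr fun n => ?_
    rw [Submodule.starProjection_orthogonal]
    simp
  refine ⟨x - y, fun n => ?_, ?_⟩
  · rw [← mem_lpMeas_iff_aestronglyMeasurable (𝕜 := ℝ)]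
    refine (hclosed n).mem_of_tendsto hlim' ?_
    filter_upwards [eventually_ge_atTop n] with k hk
    have h1 : (U k).starProjection x ∈ U k := Submodule.starProjection_apply_mem _ _
    rw [mem_lpMeas_iff_aestronglyMeasurable] at h1
    exact (mem_lpMeas_iff_aestronglyMeasurable (𝕜 := ℝ)).2 (h1.mono (hanti hk))
  · have h0 : Tendsto (fun n => ‖(U n).starProjection x - (x - y)‖) atTop (𝓝 0) :=
      tendsto_iff_norm_sub_tendsto_zero.1 hlim'
    refine squeeze_zero (fun n => integral_nonneg fun ω => abs_nonneg _) (fun n => ?_) h0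
    have hc : μ[f | G n] =ᵐ[μ] (U n).starProjection x :=
      (hf.condExpL2_ae_eq_condExp (𝕜 := ℝ) (hG n)).symm
    have hs : (fun ω => |(μ[f | G n]) ω - (x - y : Lp ℝ 2 μ) ω|) =ᵐ[μ]
        fun ω => ‖((U n).starProjection x - (x - y) : Lp ℝ 2 μ) ω‖ := by
      filter_upwards [hc, Lp.coeFn_sub ((U n).starProjection x) (x - y)] with ω h1 h2
      rw [h1, h2, Pi.sub_apply, Real.norm_eq_abs]
    rw [integral_congr_ae hs, Lp.norm_def]
    have hmem := Lp.memLp ((U n).starProjection x - (x - y))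
    have h12 : eLpNorm ((U n).starProjection x - (x - y) : Lp ℝ 2 μ) 1 μ ≤
        eLpNorm ((U n).starProjection x - (x - y) : Lp ℝ 2 μ) 2 μ :=
      eLpNorm_le_eLpNorm_of_exponent_le (by norm_num) hmem.1
    rw [integral_norm_eq_lintegral_enorm hmem.1, ← eLpNorm_one_eq_lintegral_enorm]
    exact ENNReal.toReal_mono hmem.2.ne h12

theorem integral_abs_condExp_sub_condExp_le {Ω : Type*} {m : MeasurableSpace Ω} {μ : Measure Ω}
    [IsProbabilityMeasure μ] (G : MeasurableSpace Ω) {f g : Ω → ℝ} (hf : Integrable f μ)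
    (hg : Integrable g μ) :
    ∫ ω, |(μ[f | G]) ω - (μ[g | G]) ω| ∂μ ≤ ∫ ω, |f ω - g ω| ∂μ := by
  refine le_trans (le_of_eq (integral_congr_ae ?_)) (integral_abs_condExp_le (m := G) (f - g))
  filter_upwards [condExp_sub hf hg G] with ω h
  rw [h, Pi.sub_apply]

theorem integral_abs_sub_le_add {Ω : Type*} {m : MeasurableSpace Ω} {μ : Measure Ω}
    {f g h : Ω → ℝ} (hf : Integrable f μ) (hg : Integrable g μ) (hh : Integrable h μ) :
    ∫ ω, |f ω - h ω| ∂μ ≤ ∫ ω, |f ω - g ω| ∂μ + ∫ ω, |g ω - h ω| ∂μ := by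
  refine le_trans ?_ (integral_add (f := fun ω => |f ω - g ω|) (g := fun ω => |g ω - h ω|)
    (hf.sub hg).abs (hg.sub hh).abs).le
  exact integral_mono (hf.sub hh).abs ((hf.sub hg).abs.add (hg.sub hh).abs)
    fun ω => abs_sub_le _ _ _

/-- Lévy's downward theorem in `L¹`, for a decreasing sequence of σ-algebras whose intersection
contains the null sets. -/
theorem tendsto_integral_abs_condExp_sub {Ω : Type*} {H m : MeasurableSpace Ω}
    {μ : Measure Ω} [IsProbabilityMeasure μ] {G : ℕ → MeasurableSpace Ω} (hG : ∀ n, G n ≤ m)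
    (hanti : Antitone G) (hH : ∀ n, H ≤ G n)
    (hinf : ∀ s, (∀ n, MeasurableSet[G n] s) → MeasurableSet[H] s)
    (hnull : ∀ s, μ s = 0 → MeasurableSet[H] s) {f : Ω → ℝ} (hf : Integrable f μ) :
    Tendsto (fun n => ∫ ω, |(μ[f | G n]) ω - (μ[f | H]) ω| ∂μ) atTop (𝓝 0) := by
  have hHm : H ≤ m := (hH 0).trans (hG 0)
  have htwo : ∀ g : Ω → ℝ, MemLp g 2 μ →
      Tendsto (fun n => ∫ ω, |(μ[g | G n]) ω - (μ[g | H]) ω| ∂μ) atTop (𝓝 0) := by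
    intro g hg
    obtain ⟨z, hz, hlim⟩ := tendsto_integral_abs_condExp_sub_of_memLp_two hG hanti hg
    have hzi : Integrable z μ := (Lp.memLp z).integrable (by norm_num)
    have hzH : μ[z | H] =ᵐ[μ] z := by
      refine condExp_of_aestronglyMeasurable' hHm ?_ hzi
      -- Since `H` contains the null sets, measurability up to a null set is measurability; hence
      -- `z` is measurable for every `G n`, thus for `H`.
      have hmeas : ∀ n, Measurable[G n] z := by
        intro n
        obtain ⟨w, hw, hzw⟩ := hz n
        intro s hs
        have h1 : MeasurableSet[G n] (w ⁻¹' s) := hw.measurable hs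
        have h2 : MeasurableSet[G n] ({ω | z ω ≠ w ω}) := hH n _ (hnull _ hzw)
        have h3 : MeasurableSet[G n] (z ⁻¹' s ∩ {ω | z ω ≠ w ω}) :=
          hH n _ (hnull _ (measure_mono_null Set.inter_subset_right hzw))
        have h4 : z ⁻¹' s = (w ⁻¹' s \ {ω | z ω ≠ w ω}) ∪ (z ⁻¹' s ∩ {ω | z ω ≠ w ω}) := by
          ext ω
          by_cases h : z ω = w ω <;> simp [h]
        rw [h4]
        exact (h1.diff h2).union h3
      have hm' : Measurable[H] z := fun s hs => hinf _ fun n => hmeas n hs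
      exact hm'.stronglyMeasurable.aestronglyMeasurable
    -- The limit `z` is identified by projecting on `H`: this fixes `z`, sends `μ[g | G n]` to `μ[g
    -- | H]`, and contracts L¹.
    have hbound : ∀ n, ∫ ω, |(μ[g | G n]) ω - (μ[g | H]) ω| ∂μ ≤
        ∫ ω, |(μ[g | G n]) ω - z ω| ∂μ + ∫ ω, |(μ[g | G n]) ω - z ω| ∂μ := by
      intro n
      refine (integral_abs_sub_le_add integrable_condExp hzi integrable_condExp).trans ?_
      gcongr 1
      refine le_trans (le_of_eq (integral_congr_ae ?_))
        (integral_abs_condExp_sub_condExp_le H (integrable_condExp (m := G n) (f := g)) hzi)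
      filter_upwards [hzH, condExp_condExp_of_le (f := g) (μ := μ) (hH n) (hG n)] with ω h1 h2
      rw [h1, h2, abs_sub_comm]
    refine squeeze_zero (fun n => integral_nonneg fun ω => abs_nonneg _) hbound ?_
    simpa using hlim.add hlim
  rw [Metric.tendsto_atTop]
  intro ε hε
  obtain ⟨g, hg, hg1⟩ := (memLp_one_iff_integrable.2 hf).exists_simpleFunc_eLpNorm_sub_lt
    ENNReal.one_ne_top (ε := ENNReal.ofReal (ε / 3)) (by simpa using by positivity)
  have hgi : Integrable g μ := memLp_one_iff_integrable.1 hg1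
  have hfg : ∫ ω, |f ω - g ω| ∂μ < ε / 3 := by
    have h1 := integral_norm_eq_lintegral_enorm (hf.sub hgi).1
    rw [← eLpNorm_one_eq_lintegral_enorm] at h1
    have h2 := (ENNReal.toReal_lt_toReal hg.ne_top ENNReal.ofReal_ne_top).2 hg
    rw [ENNReal.toReal_ofReal (by positivity)] at h2
    exact h1.trans_lt h2
  obtain ⟨N, hN⟩ := (Metric.tendsto_atTop.1
    (htwo g (g.memLp_of_isFiniteMeasure 2 μ))) (ε / 3) (by positivity)
  refine ⟨N, fun n hn => ?_⟩
  have h1 := hN n hn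
  rw [Real.dist_0_eq_abs, abs_of_nonneg (integral_nonneg fun ω => abs_nonneg _)] at h1 ⊢
  have h2 := integral_abs_condExp_sub_condExp_le (G n) hf hgi
  have h3 := integral_abs_condExp_sub_condExp_le H hgi hf
  have h4 := integral_abs_sub_le_add (integrable_condExp (m := G n) (f := f) (μ := μ))
    (integrable_condExp (m := G n) (f := g)) (integrable_condExp (m := H) (f := f))
  have h5 := integral_abs_sub_le_add (integrable_condExp (m := G n) (f := g) (μ := μ))
    (integrable_condExp (m := H) (f := g)) (integrable_condExp (m := H) (f := f))
  simp only [abs_sub_comm (g _) (f _)] at h3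
  linarith

/-! ### Lattice operations and gluing of stopping times. -/

variable {Ω : Type*} {m : MeasurableSpace Ω} {T : ℝ} {𝓕 : Filtration (Set.Icc (0 : ℝ) T) m}

namespace StopTime

@[ext] theorem ext {τ σ : StopTime 𝓕} (h : ∀ ω, τ ω = σ ω) : τ = σ :=
  Subtype.ext (funext h)

/-- The minimum of two stopping times. -/
def min (τ σ : StopTime 𝓕) : StopTime 𝓕 :=
  ⟨fun ω => Min.min (τ ω) (σ ω), by
    have h := τ.2.min σ.2
    simpa only [WithTop.coe_min] using h⟩

@[simp] theorem min_apply (τ σ : StopTime 𝓕) (ω : Ω) : τ.min σ ω = Min.min (τ ω) (σ ω) := rfl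

@[simp] theorem max_apply (τ σ : StopTime 𝓕) (ω : Ω) : τ.max σ ω = Max.max (τ ω) (σ ω) := rfl

theorem measurableSet_le_const (τ : StopTime 𝓕) (i : Set.Icc (0 : ℝ) T) :
    MeasurableSet[𝓕 i] {ω | τ ω ≤ i} := by
  simpa using τ.2 i

theorem measurableSet_lt_const (τ : StopTime 𝓕) (i : Set.Icc (0 : ℝ) T) :
    MeasurableSet[𝓕 i] {ω | τ ω < i} := by
  have : Nonempty (Set.Icc (0 : ℝ) T) := ⟨i⟩
  simpa using τ.2.measurableSet_lt i

theorem measurableSet_sigma_iff (τ : StopTime 𝓕) (s : Set Ω) :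
    MeasurableSet[τ.sigma] s ↔
      MeasurableSet[⨆ t, 𝓕 t] s ∧ ∀ i, MeasurableSet[𝓕 i] (s ∩ {ω | τ ω ≤ i}) := by
  rw [IsStoppingTime.measurableSet]
  simp

theorem sigma_le (τ : StopTime 𝓕) : τ.sigma ≤ m := τ.2.measurableSpace_le

theorem sigma_mono {τ σ : StopTime 𝓕} (h : ∀ ω, τ ω ≤ σ ω) : τ.sigma ≤ σ.sigma :=
  τ.2.measurableSpace_mono σ.2 fun ω => WithTop.coe_le_coe.2 (h ω)

theorem measurableSet_le (τ σ : StopTime 𝓕) : MeasurableSet[τ.sigma] {ω | τ ω ≤ σ ω} := by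
  simpa using τ.2.measurableSet_le_stopping_time σ.2

theorem measurableSet_min_le (τ σ : StopTime 𝓕) :
    MeasurableSet[(τ.min σ).sigma] {ω | τ ω ≤ σ ω} := by
  have : {ω | τ ω ≤ σ ω} = {ω | τ ω ≤ τ.min σ ω} := by ext; simp
  rw [this]
  simpa using τ.2.measurableSet_stopping_time_le (τ.min σ).2

theorem measurable_coe (τ : StopTime 𝓕) : Measurable fun ω => (τ ω : ℝ) := by
  refine measurable_of_Iic fun x => ?_
  by_cases hx : 0 ≤ x
  · by_cases hxT : x ≤ T
    · convert 𝓕.le ⟨x, hx, hxT⟩ _ (τ.measurableSet_le_const ⟨x, hx, hxT⟩) using 1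
      ext ω
      simp [← Subtype.coe_le_coe]
    · convert MeasurableSet.univ using 1
      ext ω
      simpa using (τ ω).2.2.trans (not_le.1 hxT).le
  · convert MeasurableSet.empty using 1
    ext ω
    simpa using (not_le.1 hx).trans_le (τ ω).2.1

open Classical in
/-- The stopping time equal to `τ` on `A` and to `σ` off `A`, where `A` is prior to a lower
bound `S` of both. -/
noncomputable def glue {S : StopTime 𝓕} {A : Set Ω} (hA : MeasurableSet[S.sigma] A)
    {τ σ : StopTime 𝓕} (hτ : ∀ ω, S ω ≤ τ ω) (hσ : ∀ ω, S ω ≤ σ ω) : StopTime 𝓕 :=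
  ⟨fun ω => if ω ∈ A then τ ω else σ ω, by
    intro i
    have h : {ω | ((if ω ∈ A then τ ω else σ ω : Set.Icc (0 : ℝ) T) :
        WithTop (Set.Icc (0 : ℝ) T)) ≤ i} =
        (A ∩ {ω | S ω ≤ i}) ∩ {ω | τ ω ≤ i} ∪ (Aᶜ ∩ {ω | S ω ≤ i}) ∩ {ω | σ ω ≤ i} := by
      ext ω
      have h1 := hτ ω
      have h2 := hσ ω
      by_cases h : ω ∈ A
      · simpa [h] using h1.trans
      · simpa [h] using h2.trans
    rw [h]
    exact ((((S.measurableSet_sigma_iff A).1 hA).2 i).inter (τ.measurableSet_le_const i)).union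
      ((((S.measurableSet_sigma_iff Aᶜ).1 hA.compl).2 i).inter (σ.measurableSet_le_const i))⟩

section glue

variable {S : StopTime 𝓕} {A : Set Ω} (hA : MeasurableSet[S.sigma] A) {τ σ : StopTime 𝓕}
  (hτ : ∀ ω, S ω ≤ τ ω) (hσ : ∀ ω, S ω ≤ σ ω)

theorem glue_of_mem {ω : Ω} (h : ω ∈ A) : glue hA hτ hσ ω = τ ω := if_pos h

theorem glue_of_notMem {ω : Ω} (h : ω ∉ A) : glue hA hτ hσ ω = σ ω := if_neg h

theorem le_glue (ω : Ω) : S ω ≤ glue hA hτ hσ ω := by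
  by_cases h : ω ∈ A
  · exact (hτ ω).trans_eq (glue_of_mem hA hτ hσ h).symm
  · exact (hσ ω).trans_eq (glue_of_notMem hA hτ hσ h).symm

end glue

theorem exists_isLUB (σ : ℕ → StopTime 𝓕) :
    ∃ ρ : StopTime 𝓕, ∀ ω, IsLUB (Set.range fun n => σ n ω) (ρ ω) := by
  rcases isEmpty_or_nonempty Ω with h | ⟨⟨ω₀⟩⟩
  · exact ⟨σ 0, fun ω => h.elim ω⟩
  have : Fact ((0 : ℝ) ≤ T) := ⟨(σ 0 ω₀).2.1.trans (σ 0 ω₀).2.2⟩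
  have h : ∀ ω, IsLUB (Set.range fun n => σ n ω) (⨆ n, σ n ω) := fun ω => isLUB_iSup
  refine ⟨⟨fun ω => ⨆ n, σ n ω, fun i => ?_⟩, h⟩
  have : {ω | ((⨆ n, σ n ω : Set.Icc (0 : ℝ) T) : WithTop (Set.Icc (0 : ℝ) T)) ≤ i} =
      ⋂ n, {ω | σ n ω ≤ i} := by
    ext ω
    simp
  rw [this]
  exact MeasurableSet.iInter fun n => (σ n).measurableSet_le_const i

theorem exists_isGLB [𝓕.IsRightContinuous] (σ : ℕ → StopTime 𝓕) :
    ∃ ρ : StopTime 𝓕, ∀ ω, IsGLB (Set.range fun n => σ n ω) (ρ ω) := by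
  rcases isEmpty_or_nonempty Ω with h | ⟨⟨ω₀⟩⟩
  · exact ⟨σ 0, fun ω => h.elim ω⟩
  have : Fact ((0 : ℝ) ≤ T) := ⟨(σ 0 ω₀).2.1.trans (σ 0 ω₀).2.2⟩
  have h : ∀ ω, IsGLB (Set.range fun n => σ n ω) (⨅ n, σ n ω) := fun ω => isGLB_iInf
  have hlt : ∀ i, MeasurableSet[𝓕 i] {ω | ⨅ n, σ n ω < i} := by
    intro i
    have : {ω | ⨅ n, σ n ω < i} = ⋃ n, {ω | σ n ω < i} := by
      ext ω
      simp [iInf_lt_iff]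
    rw [this]
    exact MeasurableSet.iUnion fun n => (σ n).measurableSet_lt_const i
  refine ⟨⟨fun ω => ⨅ n, σ n ω, ?_⟩, h⟩
  refine isStoppingTime_of_measurableSet_lt_of_isRightContinuous' (fun i => by simpa using hlt i)
    fun i hi => ?_
  -- A point with no right neighbourhood is the top of the interval, where equality is the
  -- complement of strict inequality.
  have hmax : ∀ j, j ≤ i := by
    intro j
    by_contra hj
    exact (nhdsGT_neBot_of_exists_gt ⟨j, not_le.1 hj⟩).ne hi
  convert (hlt i).compl using 1
  ext ω
  simp only [Set.mem_ofPred_eq, WithTop.coe_inj, Set.mem_compl_iff, not_lt]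
  exact ⟨fun h => h.ge, fun h => (hmax _).antisymm h⟩

end StopTime

/-! ### Monotone limits of stopping times. -/

/-- `σ n ↓ S` at every sample point. -/
def SurelyDecreasesTo (σ : ℕ → StopTime 𝓕) (S : StopTime 𝓕) : Prop :=
  ∀ ω, Antitone (fun n => σ n ω) ∧ Tendsto (fun n => σ n ω) atTop (𝓝 (S ω))

/-- `σ n ↑ S` at every sample point. -/
def SurelyIncreasesTo (σ : ℕ → StopTime 𝓕) (S : StopTime 𝓕) : Prop :=
  ∀ ω, Monotone (fun n => σ n ω) ∧ Tendsto (fun n => σ n ω) atTop (𝓝 (S ω))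

theorem SurelyDecreasesTo.le {σ : ℕ → StopTime 𝓕} {S : StopTime 𝓕} (h : SurelyDecreasesTo σ S)
    (n : ℕ) (ω : Ω) : S ω ≤ σ n ω := (h ω).1.le_of_tendsto (h ω).2 n

theorem SurelyIncreasesTo.le {σ : ℕ → StopTime 𝓕} {S : StopTime 𝓕} (h : SurelyIncreasesTo σ S)
    (n : ℕ) (ω : Ω) : σ n ω ≤ S ω := (h ω).1.ge_of_tendsto (h ω).2 n

theorem SurelyDecreasesTo.max_right {σ : ℕ → StopTime 𝓕} {S : StopTime 𝓕}
    (h : SurelyDecreasesTo σ S) (τ : StopTime 𝓕) :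
    SurelyDecreasesTo (fun n => τ.max (σ n)) (τ.max S) := fun ω =>
  ⟨fun _ _ hij => max_le_max le_rfl ((h ω).1 hij), tendsto_const_nhds.max (h ω).2⟩

/-- On `{S ≤ i}` some `σ n` is below any given `j > i`, so `A ∩ {S ≤ i}` lies in `𝓕 j` for all such
`j`, and right continuity brings it into `𝓕 i`. -/
theorem SurelyDecreasesTo.measurableSet_sigma [𝓕.IsRightContinuous] {σ : ℕ → StopTime 𝓕}
    {S : StopTime 𝓕} (h : SurelyDecreasesTo σ S) {A : Set Ω}
    (hA : ∀ n, MeasurableSet[(σ n).sigma] A) : MeasurableSet[S.sigma] A := by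
  rw [S.measurableSet_sigma_iff]
  refine ⟨(((σ 0).measurableSet_sigma_iff A).1 (hA 0)).1, fun i => ?_⟩
  by_cases hi : IsMax i
  · have h1 : A ∩ {ω | S ω ≤ i} = A ∩ {ω | σ 0 ω ≤ i} := by
      ext ω
      have h2 : ∀ j, j ≤ i := fun j => (le_total j i).elim id fun hj => hi hj
      simp [h2]
    rw [h1]
    exact (((σ 0).measurableSet_sigma_iff A).1 (hA 0)).2 i
  · refine Filtration.IsRightContinuous.measurableSet ?_
    obtain ⟨j₀, hj₀⟩ := not_isMax_iff.1 hi
    have : (𝓝[>] i).NeBot := nhdsGT_neBot_of_exists_gt ⟨j₀, hj₀⟩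
    rw [Filtration.rightCont_eq_of_neBot_nhdsGT]
    simp only [MeasurableSpace.measurableSet_iInf]
    intro j hj
    have h1 : A ∩ {ω | S ω ≤ i} = (⋃ n, A ∩ {ω | σ n ω ≤ j}) ∩ {ω | S ω ≤ i} := by
      ext ω
      simp only [Set.mem_inter_iff, Set.mem_ofPred_eq, Set.mem_iUnion, exists_and_left]
      refine ⟨fun ⟨ha, hS⟩ => ⟨⟨ha, ?_⟩, hS⟩, fun h => ⟨h.1.1, h.2⟩⟩
      obtain ⟨n, hn⟩ := ((h ω).2.eventually_lt_const (hS.trans_lt hj)).exists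
      exact ⟨n, hn.le⟩
    rw [h1]
    exact (MeasurableSet.iUnion fun n => (((σ n).measurableSet_sigma_iff A).1 (hA n)).2 j).inter
      (𝓕.mono hj.le _ (S.measurableSet_le_const i))

theorem IsStandardFiltration.measurableSet_sigma_of_null {μ : Measure Ω} {hT : 0 ≤ T}
    (h : IsStandardFiltration μ hT 𝓕) (S : StopTime 𝓕) {A : Set Ω} (hA : μ A = 0) :
    MeasurableSet[S.sigma] A := by
  rw [S.measurableSet_sigma_iff]
  refine ⟨le_iSup 𝓕 ⟨0, Set.left_mem_Icc.2 hT⟩ _ (h.null_sets A hA), fun i => ?_⟩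
  exact 𝓕.mono (show ⟨0, Set.left_mem_Icc.2 hT⟩ ≤ i from i.2.1) _
    (h.null_sets _ (measure_mono_null Set.inter_subset_left hA))

/-! ### The single stopping problem. -/

/-- Reward families for which the single stopping problem is solvable: the expected reward is
upper semicontinuous along decreasing sequences of stopping times, and along sequences of stopping
times squeezed between an increasing sequence and its limit. -/
structure IsReward (μ : Measure Ω) (X : StopTime 𝓕 → Ω → ℝ) : Prop where
  integrable : ∀ τ, Integrable (X τ) μ
  compatible : ∀ τ τ' : StopTime 𝓕, ∀ᵐ ω ∂μ, τ ω = τ' ω → X τ ω = X τ' ω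
  bounded : ∃ C, ∀ τ, ∫ ω, X τ ω ∂μ ≤ C
  right_usc : ∀ (σ : ℕ → StopTime 𝓕) (θ : StopTime 𝓕), SurelyDecreasesTo σ θ →
    ∀ c, (∀ n, c ≤ ∫ ω, X (σ n) ω ∂μ) → c ≤ ∫ ω, X θ ω ∂μ
  left_usc : ∀ (ρ σ : ℕ → StopTime 𝓕) (θ : StopTime 𝓕), SurelyIncreasesTo ρ θ →
    (∀ n ω, ρ n ω ≤ σ n ω) → (∀ n ω, σ n ω ≤ θ ω) →
    ∀ c, (∀ n, c ≤ ∫ ω, X (σ n) ω ∂μ) → c ≤ ∫ ω, X θ ω ∂μ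

theorem surelyIncreasesTo_of_isLUB {ρ : ℕ → StopTime 𝓕} {θ : StopTime 𝓕}
    (hρ : ∀ n ω, ρ n ω ≤ ρ (n + 1) ω) (hθ : ∀ ω, IsLUB (Set.range fun n => ρ n ω) (θ ω)) :
    SurelyIncreasesTo ρ θ := fun ω =>
  have hmono : Monotone fun n => ρ n ω := monotone_nat_of_le_succ fun n => hρ n ω
  ⟨hmono, tendsto_atTop_isLUB hmono (hθ ω)⟩

theorem surelyDecreasesTo_of_isGLB {ρ : ℕ → StopTime 𝓕} {θ : StopTime 𝓕}
    (hρ : ∀ n ω, ρ (n + 1) ω ≤ ρ n ω) (hθ : ∀ ω, IsGLB (Set.range fun n => ρ n ω) (θ ω)) :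
    SurelyDecreasesTo ρ θ := fun ω =>
  have hanti : Antitone fun n => ρ n ω := antitone_nat_of_succ_le fun n => hρ n ω
  ⟨hanti, tendsto_atTop_isGLB hanti (hθ ω)⟩

theorem StopTime.integrable_coe (μ : Measure Ω) [IsProbabilityMeasure μ] (τ : StopTime 𝓕) :
    Integrable (fun ω => (τ ω : ℝ)) μ :=
  Integrable.of_bound τ.measurable_coe.aestronglyMeasurable T
    (ae_of_all _ fun ω => by
      rw [Real.norm_eq_abs, abs_of_nonneg (τ ω).2.1]
      exact (τ ω).2.2)

theorem StopTime.integral_coe_mono (μ : Measure Ω) [IsProbabilityMeasure μ] {τ σ : StopTime 𝓕}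
    (h : ∀ ω, τ ω ≤ σ ω) : ∫ ω, (τ ω : ℝ) ∂μ ≤ ∫ ω, (σ ω : ℝ) ∂μ :=
  integral_mono (τ.integrable_coe μ) (σ.integrable_coe μ) h

theorem StopTime.ae_eq_of_integral_coe_le {μ : Measure Ω} [IsProbabilityMeasure μ]
    {τ σ : StopTime 𝓕} (h : ∀ ω, τ ω ≤ σ ω) (hint : ∫ ω, (σ ω : ℝ) ∂μ ≤ ∫ ω, (τ ω : ℝ) ∂μ) :
    ∀ᵐ ω ∂μ, τ ω = σ ω := by
  have h1 := (integral_eq_iff_of_ae_le (τ.integrable_coe μ) (σ.integrable_coe μ)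
    (ae_of_all μ h)).1 (le_antisymm (StopTime.integral_coe_mono μ h) hint)
  filter_upwards [h1] with ω hω using Subtype.ext hω

/-- A class of stopping times that is closed under limits of increasing sequences has a maximal
element, up to almost sure equality. -/
theorem StopTime.exists_maximal (μ : Measure Ω) [IsProbabilityMeasure μ]
    {p : StopTime 𝓕 → Prop} {S : StopTime 𝓕} (hS : p S)
    (hp : ∀ (ρ : ℕ → StopTime 𝓕) (θ : StopTime 𝓕), (∀ n, p (ρ n)) → SurelyIncreasesTo ρ θ → p θ) :
    ∃ θ : StopTime 𝓕, p θ ∧ ∀ ρ : StopTime 𝓕, p ρ → (∀ ω, θ ω ≤ ρ ω) → ∀ᵐ ω ∂μ, θ ω = ρ ω := by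
  -- Greedy exhaustion: each step comes within `1 / (n + 1)` of the largest mean time available
  -- above `ρ`, so nothing in the class above the limit has a larger mean.
  have hnext : ∀ (n : ℕ) (ρ : {ρ : StopTime 𝓕 // p ρ}), ∃ ρ' : {ρ : StopTime 𝓕 // p ρ},
      (∀ ω, ρ.1 ω ≤ ρ'.1 ω) ∧ ∀ σ : StopTime 𝓕, p σ → (∀ ω, ρ.1 ω ≤ σ ω) →
        ∫ ω, (σ ω : ℝ) ∂μ ≤ ∫ ω, (ρ'.1 ω : ℝ) ∂μ + 1 / ((n : ℝ) + 1) := by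
    intro n ρ
    let s : Set ℝ := {x | ∃ σ : StopTime 𝓕, p σ ∧ (∀ ω, ρ.1 ω ≤ σ ω) ∧ ∫ ω, (σ ω : ℝ) ∂μ = x}
    have hne : s.Nonempty := ⟨_, ρ.1, ρ.2, fun _ => le_rfl, rfl⟩
    have hbdd : BddAbove s := by
      refine ⟨T, ?_⟩
      rintro x ⟨σ, -, -, rfl⟩
      calc ∫ ω, (σ ω : ℝ) ∂μ ≤ ∫ _, T ∂μ :=
            integral_mono (σ.integrable_coe μ) (integrable_const T) fun ω => (σ ω).2.2
        _ = T := by simp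
    obtain ⟨x, ⟨σ, hσ, hρσ, rfl⟩, hx⟩ := exists_lt_of_lt_csSup hne
      (show sSup s - 1 / ((n : ℝ) + 1) < sSup s by
        have : (0 : ℝ) < 1 / ((n : ℝ) + 1) := by positivity
        linarith)
    refine ⟨⟨σ, hσ⟩, hρσ, fun τ hτ hρτ => ?_⟩
    have := le_csSup hbdd ⟨τ, hτ, hρτ, rfl⟩
    linarith
  choose next hle hmax using hnext
  let seq : ℕ → {ρ : StopTime 𝓕 // p ρ} := fun n => Nat.rec ⟨S, hS⟩ next n
  have hseq : ∀ n ω, (seq n).1 ω ≤ (seq (n + 1)).1 ω := fun n => hle n (seq n)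
  obtain ⟨θ, hθ⟩ := StopTime.exists_isLUB fun n => (seq n).1
  have hinc := surelyIncreasesTo_of_isLUB hseq hθ
  refine ⟨θ, hp _ θ (fun n => (seq n).2) hinc, fun ρ hρ hθρ => ?_⟩
  refine StopTime.ae_eq_of_integral_coe_le hθρ ?_
  have hlim : Tendsto (fun n : ℕ => ∫ ω, (θ ω : ℝ) ∂μ + 1 / ((n : ℝ) + 1)) atTop
      (𝓝 (∫ ω, (θ ω : ℝ) ∂μ)) := by
    simpa using tendsto_const_nhds.add (tendsto_one_div_add_atTop_nhds_zero_nat (𝕜 := ℝ))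
  refine ge_of_tendsto' hlim fun n => ?_
  refine (hmax n (seq n) ρ hρ fun ω => (hinc.le n ω).trans (hθρ ω)).trans ?_
  gcongr 1
  exact StopTime.integral_coe_mono μ (hinc.le (n + 1))

namespace IsReward

variable {μ : Measure Ω} {X : StopTime 𝓕 → Ω → ℝ}

theorem integral_congr (hX : IsReward μ X) {τ σ : StopTime 𝓕} (h : ∀ᵐ ω ∂μ, τ ω = σ ω) :
    ∫ ω, X τ ω ∂μ = ∫ ω, X σ ω ∂μ := by
  refine integral_congr_ae ?_
  filter_upwards [h, hX.compatible τ σ] with ω h1 h2 using h2 h1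

/-- At each point the minimum and maximum are the two given times in some order. This modularity
controls the loss when near-optimal times are replaced by their minimum. -/
theorem integral_min_add_max (hX : IsReward μ X) (τ σ : StopTime 𝓕) :
    ∫ ω, X (τ.min σ) ω ∂μ + ∫ ω, X (τ.max σ) ω ∂μ = ∫ ω, X τ ω ∂μ + ∫ ω, X σ ω ∂μ := by
  rw [← integral_add (hX.integrable _) (hX.integrable _),
    ← integral_add (hX.integrable _) (hX.integrable _)]
  refine integral_congr_ae ?_
  filter_upwards [hX.compatible (τ.min σ) τ, hX.compatible (τ.min σ) σ,
    hX.compatible (τ.max σ) τ, hX.compatible (τ.max σ) σ] with ω h1 h2 h3 h4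
  rcases le_total (τ ω) (σ ω) with h | h
  · rw [h1 (by simp [h]), h4 (by simp [h])]
  · rw [h2 (by simp [h]), h3 (by simp [h]), add_comm]

/-- The expected reward attains its maximum over the stopping times after `S`. -/
theorem exists_max [IsProbabilityMeasure μ] [𝓕.IsRightContinuous] (hX : IsReward μ X)
    (S : StopTime 𝓕) :
    ∃ θ : StopTime 𝓕, (∀ ω, S ω ≤ θ ω) ∧
      ∀ τ : StopTime 𝓕, (∀ ω, S ω ≤ τ ω) → ∫ ω, X τ ω ∂μ ≤ ∫ ω, X θ ω ∂μ := by
  let s : Set ℝ := {x | ∃ τ : StopTime 𝓕, (∀ ω, S ω ≤ τ ω) ∧ ∫ ω, X τ ω ∂μ = x}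
  have hne : s.Nonempty := ⟨_, S, fun _ => le_rfl, rfl⟩
  have hbdd : BddAbove s := by
    obtain ⟨C, hC⟩ := hX.bounded
    refine ⟨C, ?_⟩
    rintro x ⟨τ, -, rfl⟩
    exact hC τ
  set c := sSup s
  have hle : ∀ τ : StopTime 𝓕, (∀ ω, S ω ≤ τ ω) → ∫ ω, X τ ω ∂μ ≤ c := fun τ hτ =>
    le_csSup hbdd ⟨τ, hτ, rfl⟩
  let p : StopTime 𝓕 → Prop := fun ρ => (∀ ω, S ω ≤ ρ ω) ∧
    ∀ ε > 0, ∃ τ : StopTime 𝓕, (∀ ω, ρ ω ≤ τ ω) ∧ c - ε ≤ ∫ ω, X τ ω ∂μ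
  have hpS : p S := by
    refine ⟨fun _ => le_rfl, fun ε hε => ?_⟩
    obtain ⟨x, ⟨τ, hτ, rfl⟩, hx⟩ := exists_lt_of_lt_csSup hne (show c - ε < c by linarith)
    exact ⟨τ, hτ, hx.le⟩
  have hplim : ∀ (ρ : ℕ → StopTime 𝓕) (θ : StopTime 𝓕), (∀ n, p (ρ n)) →
      SurelyIncreasesTo ρ θ → p θ := by
    intro ρ θ hρ hinc
    refine ⟨fun ω => ((hρ 0).1 ω).trans (hinc.le 0 ω), fun ε hε => ?_⟩
    choose τ hτ hτc using fun n => (hρ n).2 (ε / 2) (half_pos hε)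
    -- By left semicontinuity, cutting `τ n` at `θ` cannot always beat stopping at `θ` by `ε / 2`;
    -- modularity then makes `τ n ∨ θ` nearly optimal.
    obtain ⟨n, hn⟩ : ∃ n, ∫ ω, X ((τ n).min θ) ω ∂μ < ∫ ω, X θ ω ∂μ + ε / 2 := by
      by_contra! hcon
      have := hX.left_usc ρ (fun n => (τ n).min θ) θ hinc
        (fun n ω => le_min (hτ n ω) (hinc.le n ω)) (fun n ω => min_le_right _ _) _ hcon
      linarith
    refine ⟨(τ n).max θ, fun ω => le_max_right _ _, ?_⟩
    have h1 := hX.integral_min_add_max (τ n) θ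
    have h2 := hτc n
    linarith
  obtain ⟨θ, hθ, hmax⟩ := StopTime.exists_maximal μ hpS hplim
  refine ⟨θ, hθ.1, fun τ hτ => (hle τ hτ).trans ?_⟩
  refine le_of_forall_pos_le_add fun ε hε => ?_
  choose τ hτ hτc using fun n : ℕ => hθ.2 (ε * (1 / 2) ^ (n + 1)) (by positivity)
  -- Running minima. Since no maximum exceeds `c`, modularity makes the deficits at most add up, and
  -- the geometric weights keep their sum below `ε`.
  let σ : ℕ → StopTime 𝓕 := fun n => Nat.rec (τ 0) (fun k r => r.min (τ (k + 1))) n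
  have hσsucc : ∀ n, σ (n + 1) = (σ n).min (τ (n + 1)) := fun n => rfl
  have hθσ : ∀ n ω, θ ω ≤ σ n ω := by
    intro n ω
    induction n with
    | zero => exact hτ 0 ω
    | succ n ih => exact le_min ih (hτ (n + 1) ω)
  have hστ : ∀ n ω, σ n ω ≤ τ n ω := by
    intro n ω
    cases n with
    | zero => exact le_rfl
    | succ n => exact min_le_right _ _
  have hσc : ∀ n, c - ε * (1 - (1 / 2) ^ (n + 1)) ≤ ∫ ω, X (σ n) ω ∂μ := by
    intro n
    induction n with
    | zero =>
      refine le_trans (le_of_eq ?_) (hτc 0)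
      norm_num
    | succ n ih =>
      have h1 := hX.integral_min_add_max (σ n) (τ (n + 1))
      have h2 := hτc (n + 1)
      have h3 := hle ((σ n).max (τ (n + 1))) fun ω =>
        (hθ.1 ω).trans ((hθσ n ω).trans (le_max_left _ _))
      rw [hσsucc]
      have h4 : ε * (1 / 2) ^ (n + 1) = 2 * (ε * (1 / 2) ^ (n + 1 + 1)) := by ring
      linarith
  obtain ⟨ρ, hρ⟩ := StopTime.exists_isGLB σ
  have hdec : SurelyDecreasesTo σ ρ :=
    surelyDecreasesTo_of_isGLB (fun n ω => min_le_left _ _) hρ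
  have hθρ : ∀ ω, θ ω ≤ ρ ω := fun ω => (hρ ω).2 (by rintro _ ⟨n, rfl⟩; exact hθσ n ω)
  -- The infimum `ρ` lies below every `τ n`, whose deficits tend to zero. Maximality of `θ` then
  -- forces `ρ = θ` almost surely.
  have hpρ : p ρ := by
    refine ⟨fun ω => (hθ.1 ω).trans (hθρ ω), fun δ hδ => ?_⟩
    obtain ⟨n, hn⟩ := exists_pow_lt_of_lt_one (div_pos hδ hε) (show (1 / 2 : ℝ) < 1 by norm_num)
    refine ⟨τ n, fun ω => (hdec.le n ω).trans (hστ n ω), le_trans ?_ (hτc n)⟩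
    have h1 : (1 / 2 : ℝ) ^ (n + 1) ≤ (1 / 2) ^ n :=
      pow_le_pow_of_le_one (by norm_num) (by norm_num) (Nat.le_succ n)
    have h2 : ε * (1 / 2) ^ (n + 1) ≤ δ := by
      rw [lt_div_iff₀ hε] at hn
      nlinarith
    linarith
  have h1 := hX.right_usc σ ρ hdec (c - ε) fun n => by
    refine le_trans ?_ (hσc n)
    have : 0 ≤ ε * (1 / 2 : ℝ) ^ (n + 1) := by positivity
    linarith
  rw [← hX.integral_congr (hmax ρ hpρ hθρ)] at h1
  linarith

/-- Using `τ` on `A` and `θ` elsewhere is again admissible, so a gain on `A` would contradict the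
maximality of `θ`. -/
theorem setIntegral_le_of_max (hX : IsReward μ X) {S θ : StopTime 𝓕} (hθ : ∀ ω, S ω ≤ θ ω)
    (hmax : ∀ τ : StopTime 𝓕, (∀ ω, S ω ≤ τ ω) → ∫ ω, X τ ω ∂μ ≤ ∫ ω, X θ ω ∂μ)
    {τ : StopTime 𝓕} (hτ : ∀ ω, S ω ≤ τ ω) {A : Set Ω} (hA : MeasurableSet[S.sigma] A) :
    ∫ ω in A, X τ ω ∂μ ≤ ∫ ω in A, X θ ω ∂μ := by
  have hAm := S.sigma_le _ hA
  have h1 := hmax _ (StopTime.le_glue hA hτ hθ)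
  rw [← integral_add_compl hAm (hX.integrable _), ← integral_add_compl hAm (hX.integrable θ)] at h1
  have h2 : ∫ ω in A, X (StopTime.glue hA hτ hθ) ω ∂μ = ∫ ω in A, X τ ω ∂μ := by
    refine setIntegral_congr_ae hAm ?_
    filter_upwards [hX.compatible (StopTime.glue hA hτ hθ) τ] with ω h hω
    exact h (StopTime.glue_of_mem hA hτ hθ hω)
  have h3 : ∫ ω in Aᶜ, X (StopTime.glue hA hτ hθ) ω ∂μ = ∫ ω in Aᶜ, X θ ω ∂μ := by
    refine setIntegral_congr_ae hAm.compl ?_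
    filter_upwards [hX.compatible (StopTime.glue hA hτ hθ) θ] with ω h hω
    exact h (StopTime.glue_of_notMem hA hτ hθ hω)
  linarith

end IsReward

theorem condExp_le_condExp_of_setIntegral_le {G m' : MeasurableSpace Ω} {ν : Measure[m'] Ω}
    [IsProbabilityMeasure ν] (hG : G ≤ m') {f g : Ω → ℝ} (hf : Integrable f ν)
    (hg : Integrable g ν)
    (h : ∀ A, MeasurableSet[G] A → ∫ ω in A, f ω ∂ν ≤ ∫ ω in A, g ω ∂ν) :
    ν[f | G] ≤ᵐ[ν] ν[g | G] := by
  refine ae_le_of_ae_le_trim (hm := hG) ?_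
  refine ae_le_of_forall_setIntegral_le
    (integrable_condExp.trim hG stronglyMeasurable_condExp)
    (integrable_condExp.trim hG stronglyMeasurable_condExp) fun A hA _ => ?_
  rw [← setIntegral_trim hG stronglyMeasurable_condExp hA,
    ← setIntegral_trim hG stronglyMeasurable_condExp hA, setIntegral_condExp hG hf hA,
    setIntegral_condExp hG hg hA]
  exact h A hA

namespace IsReward

variable {μ : Measure Ω} [IsProbabilityMeasure μ] {X : StopTime 𝓕 → Ω → ℝ}

theorem condExp_le_of_max (hX : IsReward μ X) {S θ : StopTime 𝓕} (hθ : ∀ ω, S ω ≤ θ ω)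
    (hmax : ∀ τ : StopTime 𝓕, (∀ ω, S ω ≤ τ ω) → ∫ ω, X τ ω ∂μ ≤ ∫ ω, X θ ω ∂μ)
    {τ : StopTime 𝓕} (hτ : ∀ᵐ ω ∂μ, S ω ≤ τ ω) : μ[X τ | S.sigma] ≤ᵐ[μ] μ[X θ | S.sigma] := by
  have h1 : X τ =ᵐ[μ] X (S.max τ) := by
    filter_upwards [hτ, hX.compatible τ (S.max τ)] with ω h1 h2
    exact h2 (by simp [h1])
  refine (condExp_congr_ae h1).trans_le ?_
  exact condExp_le_condExp_of_setIntegral_le S.sigma_le (hX.integrable _) (hX.integrable _)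
    fun A hA => hX.setIntegral_le_of_max hθ hmax (fun ω => le_max_left _ _) hA

theorem isSingleValue_of_max (hX : IsReward μ X) {S θ : StopTime 𝓕} (hθ : ∀ ω, S ω ≤ θ ω)
    (hmax : ∀ τ : StopTime 𝓕, (∀ ω, S ω ≤ τ ω) → ∫ ω, X τ ω ∂μ ≤ ∫ ω, X θ ω ∂μ) :
    IsSingleValue μ X S (μ[X θ | S.sigma]) :=
  ⟨(stronglyMeasurable_condExp.mono S.sigma_le).measurable,
    fun τ => hX.condExp_le_of_max hθ hmax τ.2, fun _ _ h => h ⟨θ, ae_of_all _ hθ⟩⟩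

theorem isOptimal_of_max (hX : IsReward μ X) {S θ : StopTime 𝓕} (hθ : ∀ ω, S ω ≤ θ ω)
    (hmax : ∀ τ : StopTime 𝓕, (∀ ω, S ω ≤ τ ω) → ∫ ω, X τ ω ∂μ ≤ ∫ ω, X θ ω ∂μ) :
    IsOptimal μ X S θ :=
  ⟨ae_of_all _ hθ, _, hX.isSingleValue_of_max hθ hmax, EventuallyEq.rfl⟩

end IsReward

/-! ### Pair rewards and the inner problems. -/

theorem integral_le_integral_add_abs_sub {μ : Measure Ω} {f g : Ω → ℝ} (hf : Integrable f μ)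
    (hg : Integrable g μ) : ∫ ω, f ω ∂μ ≤ ∫ ω, g ω ∂μ + ∫ ω, |f ω - g ω| ∂μ := by
  refine le_trans ?_ (integral_add (f := g) (g := fun ω => |f ω - g ω|) hg (hf.sub hg).abs).le
  exact integral_mono hf (hg.add (hf.sub hg).abs) fun ω => by
    have := le_abs_self (f ω - g ω)
    linarith

/-- An absolute value is the number plus twice its negative part, and the negative part of `f - g`
is at most `|l - g|`. Thus a pointwise lower bound and an upper bound in mean suffice for L¹
convergence. -/
theorem integral_abs_sub_le_of_ae_le {μ : Measure Ω} {f g l : Ω → ℝ} (hf : Integrable f μ)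
    (hg : Integrable g μ) (hl : Integrable l μ) (hlf : l ≤ᵐ[μ] f) :
    ∫ ω, |f ω - g ω| ∂μ ≤
      (∫ ω, f ω ∂μ - ∫ ω, g ω ∂μ) + 2 * ∫ ω, |l ω - g ω| ∂μ := by
  rw [← integral_sub hf hg, ← integral_const_mul]
  refine le_trans ?_ (integral_add (f := fun ω => f ω - g ω) (g := fun ω => 2 * |l ω - g ω|)
    (hf.sub hg) ((hl.sub hg).abs.const_mul 2)).le
  refine integral_mono_ae (hf.sub hg).abs ((hf.sub hg).add ((hl.sub hg).abs.const_mul 2)) ?_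
  filter_upwards [hlf] with ω hω
  rcases abs_cases (f ω - g ω) with h | h <;> rcases abs_cases (l ω - g ω) with h' | h' <;>
    linarith

/-- Families indexed by pairs of stopping times, dominated by an integrable random variable `Z`,
which are continuous in mean in each variable along monotone sequences of stopping times, uniformly
in the other variable. -/
structure IsPairReward (μ : Measure Ω) (K : StopTime 𝓕 → StopTime 𝓕 → Ω → ℝ) (Z : Ω → ℝ) :
    Prop where
  integrable_bound : Integrable Z μ
  bound : ∀ θ S, ∀ᵐ ω ∂μ, |K θ S ω| ≤ Z ω
  aestronglyMeasurable : ∀ θ S, AEStronglyMeasurable (K θ S) μ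
  compatible : ∀ θ θ' S S' : StopTime 𝓕,
    ∀ᵐ ω ∂μ, θ ω = θ' ω → S ω = S' ω → K θ S ω = K θ' S' ω
  right_snd : ∀ (η σ : ℕ → StopTime 𝓕) (S : StopTime 𝓕), SurelyDecreasesTo σ S →
    Tendsto (fun n => ∫ ω, |K (η n) (σ n) ω - K (η n) S ω| ∂μ) atTop (𝓝 0)
  left_snd : ∀ (η σ : ℕ → StopTime 𝓕) (S : StopTime 𝓕), SurelyIncreasesTo σ S →
    Tendsto (fun n => ∫ ω, |K (η n) (σ n) ω - K (η n) S ω| ∂μ) atTop (𝓝 0)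
  right_fst : ∀ (η σ : ℕ → StopTime 𝓕) (S : StopTime 𝓕), SurelyDecreasesTo σ S →
    Tendsto (fun n => ∫ ω, |K (σ n) (η n) ω - K S (η n) ω| ∂μ) atTop (𝓝 0)
  left_fst : ∀ (η σ : ℕ → StopTime 𝓕) (S : StopTime 𝓕), SurelyIncreasesTo σ S →
    Tendsto (fun n => ∫ ω, |K (σ n) (η n) ω - K S (η n) ω| ∂μ) atTop (𝓝 0)

/-- `o η` maximizes the expectation of `K τ η` over the stopping times `τ` after `η`. -/
def IsInnerOptimizer (μ : Measure Ω) (K : StopTime 𝓕 → StopTime 𝓕 → Ω → ℝ)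
    (o : StopTime 𝓕 → StopTime 𝓕) : Prop :=
  ∀ η, (∀ ω, η ω ≤ o η ω) ∧
    ∀ τ : StopTime 𝓕, (∀ ω, η ω ≤ τ ω) → ∫ ω, K τ η ω ∂μ ≤ ∫ ω, K (o η) η ω ∂μ

/-- The value of the inner problem with optimal stopping times `o`. -/
noncomputable def innerValue (μ : Measure Ω) (K : StopTime 𝓕 → StopTime 𝓕 → Ω → ℝ)
    (o : StopTime 𝓕 → StopTime 𝓕) (η : StopTime 𝓕) : Ω → ℝ :=
  μ[K (o η) η | η.sigma]

theorem integrable_innerValue (μ : Measure Ω) (K : StopTime 𝓕 → StopTime 𝓕 → Ω → ℝ)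
    (o : StopTime 𝓕 → StopTime 𝓕) (η : StopTime 𝓕) : Integrable (innerValue μ K o η) μ :=
  integrable_condExp

theorem StopTime.measurableSet_eq (τ σ : StopTime 𝓕) :
    MeasurableSet[τ.sigma] {ω | τ ω = σ ω} := by
  simpa using τ.2.measurableSet_eq_stopping_time σ.2

theorem StopTime.measurableSet_eq_inter_iff (τ σ : StopTime 𝓕) (t : Set Ω) :
    MeasurableSet[τ.sigma] ({ω | τ ω = σ ω} ∩ t) ↔
      MeasurableSet[σ.sigma] ({ω | τ ω = σ ω} ∩ t) := by
  simp only [StopTime.measurableSet_sigma_iff]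
  have h : ∀ i, {ω | τ ω = σ ω} ∩ t ∩ {ω | τ ω ≤ i} = {ω | τ ω = σ ω} ∩ t ∩ {ω | σ ω ≤ i} := by
    intro i
    ext ω
    simp only [Set.mem_inter_iff, Set.mem_ofPred_eq, and_congr_right_iff, and_imp]
    intro h _
    rw [h]
  simp only [h]

theorem condExp_congr_ae_restrict {G m' : MeasurableSpace Ω} {ν : Measure[m'] Ω}
    [IsProbabilityMeasure ν] {B : Set Ω} (hB : MeasurableSet[G] B)
    {f g : Ω → ℝ} (hf : Integrable f ν) (hg : Integrable g ν) (h : f =ᵐ[ν.restrict B] g) :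
    ν[f | G] =ᵐ[ν.restrict B] ν[g | G] := by
  have h1 : ν[f - g | G] =ᵐ[ν.restrict B] 0 := by
    refine condExp_ae_eq_restrict_zero hB ?_
    filter_upwards [h] with ω hω
    simp [hω]
  filter_upwards [h1, ae_restrict_of_ae (condExp_sub hf hg G)] with ω h2 h3
  rw [h3, Pi.sub_apply, Pi.zero_apply] at h2
  linarith

namespace IsPairReward

variable {μ : Measure Ω} {K : StopTime 𝓕 → StopTime 𝓕 → Ω → ℝ} {Z : Ω → ℝ}

theorem swap (hK : IsPairReward μ K Z) : IsPairReward μ (fun θ S => K S θ) Z where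
  integrable_bound := hK.integrable_bound
  bound θ S := hK.bound S θ
  aestronglyMeasurable θ S := hK.aestronglyMeasurable S θ
  compatible θ θ' S S' := by
    filter_upwards [hK.compatible S S' θ θ'] with ω h h1 h2 using h h2 h1
  right_snd := hK.right_fst
  left_snd := hK.left_fst
  right_fst := hK.right_snd
  left_fst := hK.left_snd

theorem integrable (hK : IsPairReward μ K Z) (θ S : StopTime 𝓕) : Integrable (K θ S) μ :=
  hK.integrable_bound.mono' (hK.aestronglyMeasurable θ S) (hK.bound θ S)

theorem left_snd_of_squeezed [IsProbabilityMeasure μ] [𝓕.IsRightContinuous]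
    (hK : IsPairReward μ K Z) {η ρ σ : ℕ → StopTime 𝓕} {θ : StopTime 𝓕}
    (hρ : SurelyIncreasesTo ρ θ) (hρσ : ∀ n ω, ρ n ω ≤ σ n ω) (hσ : ∀ n ω, σ n ω ≤ θ ω) :
    Tendsto (fun n => ∫ ω, |K (η n) (σ n) ω - K (η n) θ ω| ∂μ) atTop (𝓝 0) := by
  -- For fixed `n` these events shrink to the empty set in `j`, because `ρ j` increases to `θ`; so
  -- their mass under `2 * Z` vanishes.
  let bad : ℕ → ℕ → Set Ω := fun n j => {ω | ρ j ω ≤ σ n ω} ∩ {ω | θ ω ≤ σ n ω}ᶜ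
  have hbadm : ∀ n j, MeasurableSet (bad n j) := fun n j =>
    ((ρ j).sigma_le _ ((ρ j).measurableSet_le _)).inter
      (θ.sigma_le _ (θ.measurableSet_le _)).compl
  have h2Z : Integrable (fun ω => 2 * Z ω) μ := hK.integrable_bound.const_mul 2
  have hJ : ∀ n, ∃ J, ∀ j ≥ J, ∫ ω in bad n j, 2 * Z ω ∂μ < 1 / ((n : ℝ) + 1) := by
    intro n
    have h1 := tendsto_setIntegral_of_antitone (μ := μ) (f := fun ω => 2 * Z ω) (s := bad n)
      (hbadm n) (fun i j hij ω hω => ⟨((hρ ω).1 hij).trans hω.1, hω.2⟩) ⟨0, h2Z.integrableOn⟩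
    have h2 : ⋂ j, bad n j = ∅ := by
      rw [Set.eq_empty_iff_forall_notMem]
      intro ω hω
      rw [Set.mem_iInter] at hω
      exact (hω 0).2 (le_of_tendsto' (hρ ω).2 fun j => (hω j).1)
    rw [h2, setIntegral_empty] at h1
    exact eventually_atTop.1 (h1.eventually_lt_const (by positivity))
  choose J hJ using hJ
  refine tendsto_of_subseq_tendsto fun ns hns => ?_
  choose f hf using fun a => (hns.eventually_ge_atTop (max (J (ns a)) (ns a + 1))).exists
  refine ⟨fun k => f^[k] 0, ?_⟩
  let N : ℕ → ℕ := fun k => ns (f^[k] 0)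
  have hNsucc : ∀ k, max (J (N k)) (N k + 1) ≤ N (k + 1) := fun k => by
    simp only [N, Function.iterate_succ_apply']
    exact hf _
  have hN : StrictMono N := strictMono_nat_of_lt_succ fun k => (le_max_right _ _).trans (hNsucc k)
  -- Tail infima along a sparse subsequence do increase to `θ`. Off the bad event `σ (N k)` is
  -- either `θ` or below all later terms, hence equal to `r k`.
  choose r hr using fun k => StopTime.exists_isGLB fun j => σ (N (k + j))
  have hrσ : ∀ k ω, r k ω ≤ σ (N k) ω := fun k ω => (hr k ω).1 ⟨0, rfl⟩
  have hρr : ∀ k ω, ρ (N k) ω ≤ r k ω := by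
    intro k ω
    refine (hr k ω).2 ?_
    rintro _ ⟨j, rfl⟩
    exact ((hρ ω).1 (hN.monotone (Nat.le_add_right k j))).trans (hρσ _ ω)
  have hrinc : SurelyIncreasesTo r θ := by
    intro ω
    refine ⟨monotone_nat_of_le_succ fun k => (hr (k + 1) ω).2 ?_, ?_⟩
    · rintro _ ⟨j, rfl⟩
      refine (hr k ω).1 ⟨j + 1, ?_⟩
      simp only [add_assoc, add_comm 1 j]
    · exact tendsto_of_tendsto_of_tendsto_of_le_of_le ((hρ ω).2.comp hN.tendsto_atTop)
        tendsto_const_nhds (fun k => hρr k ω) fun k => (hrσ k ω).trans (hσ _ ω)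
  have hlim1 := hK.left_snd (fun k => η (N k)) r θ hrinc
  have hlim2 : Tendsto (fun k => 1 / ((N k : ℝ) + 1)) atTop (𝓝 0) :=
    (tendsto_one_div_add_atTop_nhds_zero_nat (𝕜 := ℝ)).comp hN.tendsto_atTop
  have hlim := hlim1.add hlim2
  rw [add_zero] at hlim
  refine squeeze_zero (fun k => integral_nonneg fun ω => abs_nonneg _) (fun k => ?_) hlim
  change ∫ ω, |K (η (N k)) (σ (N k)) ω - K (η (N k)) θ ω| ∂μ ≤ _
  have hbad := hJ (N k) (N (k + 1)) ((le_max_left _ _).trans (hNsucc k))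
  have hb := hbadm (N k) (N (k + 1))
  have hi : ∀ σ : StopTime 𝓕, Integrable (fun ω => |K (η (N k)) σ ω - K (η (N k)) θ ω|) μ :=
    fun σ => ((hK.integrable _ _).sub (hK.integrable _ _)).abs
  rw [← integral_indicator hb] at hbad
  refine le_trans ?_ (add_le_add_right hbad.le _)
  rw [← integral_add (hi _) (h2Z.indicator hb)]
  refine integral_mono_ae (hi _) ((hi _).add (h2Z.indicator hb)) ?_
  filter_upwards [hK.compatible (η (N k)) (η (N k)) (σ (N k)) θ,
    hK.compatible (η (N k)) (η (N k)) (σ (N k)) (r k), hK.bound (η (N k)) (σ (N k)),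
    hK.bound (η (N k)) θ] with ω h1 h2 h3 h4
  have h5 : 0 ≤ |K (η (N k)) (r k) ω - K (η (N k)) θ ω| := abs_nonneg _
  by_cases hω : ω ∈ bad (N k) (N (k + 1))
  · rw [Set.indicator_of_mem hω]
    have := abs_sub (K (η (N k)) (σ (N k)) ω) (K (η (N k)) θ ω)
    linarith
  · rw [Set.indicator_of_notMem hω, add_zero]
    by_cases hθ : θ ω ≤ σ (N k) ω
    · rw [h1 rfl ((hσ _ ω).antisymm hθ), sub_self, abs_zero]
      exact h5
    · have hlt : σ (N k) ω < ρ (N (k + 1)) ω := not_le.1 fun h => hω ⟨h, hθ⟩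
      have heq : σ (N k) ω = r k ω := by
        refine le_antisymm ((hr k ω).2 ?_) (hrσ k ω)
        rintro _ ⟨j, rfl⟩
        cases j with
        | zero => exact le_rfl
        | succ j =>
          refine hlt.le.trans (((hρ ω).1 (hN.monotone ?_)).trans (hρσ _ ω))
          omega
      rw [h2 rfl heq]

theorem isReward [IsProbabilityMeasure μ] [𝓕.IsRightContinuous] (hK : IsPairReward μ K Z)
    (θ : StopTime 𝓕) : IsReward μ fun τ => K τ θ where
  integrable τ := hK.integrable τ θ
  compatible τ τ' := by
    filter_upwards [hK.compatible τ τ' θ θ] with ω h h1 using h h1 rfl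
  bounded := ⟨∫ ω, Z ω ∂μ, fun τ => integral_mono_ae (hK.integrable _ _) hK.integrable_bound <| by
    filter_upwards [hK.bound τ θ] with ω h using (le_abs_self _).trans h⟩
  right_usc σ S hσ c hc := by
    have := tendsto_const_nhds (x := ∫ ω, K S θ ω ∂μ) |>.add (hK.right_fst (fun _ => θ) σ S hσ)
    rw [add_zero] at this
    exact ge_of_tendsto' this fun n => (hc n).trans
      (integral_le_integral_add_abs_sub (hK.integrable _ _) (hK.integrable _ _))
  left_usc ρ σ S hρ hρσ hσ c hc := by
    have := tendsto_const_nhds (x := ∫ ω, K S θ ω ∂μ) |>.add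
      (hK.swap.left_snd_of_squeezed (η := fun _ => θ) hρ hρσ hσ)
    rw [add_zero] at this
    exact ge_of_tendsto' this fun n => (hc n).trans
      (integral_le_integral_add_abs_sub (hK.integrable _ _) (hK.integrable _ _))

theorem exists_isInnerOptimizer [IsProbabilityMeasure μ] [𝓕.IsRightContinuous]
    (hK : IsPairReward μ K Z) : ∃ o, IsInnerOptimizer μ K o := by
  choose o ho using fun η => (hK.isReward η).exists_max η
  exact ⟨o, ho⟩

variable [IsProbabilityMeasure μ] [𝓕.IsRightContinuous] {o o' : StopTime 𝓕 → StopTime 𝓕}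

theorem condExp_le_innerValue (hK : IsPairReward μ K Z) (ho : IsInnerOptimizer μ K o)
    {η τ : StopTime 𝓕} (hτ : ∀ᵐ ω ∂μ, η ω ≤ τ ω) :
    μ[K τ η | η.sigma] ≤ᵐ[μ] innerValue μ K o η :=
  (hK.isReward η).condExp_le_of_max (ho η).1 (ho η).2 hτ

/-- On `{η = η'}` the two σ-algebras have the same trace, and `o η ∨ η'` is a competitor for `η'`
that agrees there with `o η`. -/
theorem innerValue_le_of_eq (hK : IsPairReward μ K Z) (ho : IsInnerOptimizer μ K o)
    (η η' : StopTime 𝓕) :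
    ∀ᵐ ω ∂μ, η ω = η' ω → innerValue μ K o η ω ≤ innerValue μ K o η' ω := by
  have hB := η.measurableSet_eq η'
  have hBm := η.sigma_le _ hB
  have hB' : MeasurableSet[η'.sigma] {ω | η ω = η' ω} := by
    simpa using (η.measurableSet_eq_inter_iff η' Set.univ).1 (by simpa using hB)
  have h1 : μ[K (o η) η | η.sigma] =ᵐ[μ.restrict {ω | η ω = η' ω}] μ[K (o η) η | η'.sigma] :=
    condExp_ae_eq_restrict_of_measurableSpace_eq_on η.sigma_le η'.sigma_le hB
      (η.measurableSet_eq_inter_iff η')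
  have h2 : μ[K (o η) η | η'.sigma] =ᵐ[μ.restrict {ω | η ω = η' ω}]
      μ[K ((o η).max η') η' | η'.sigma] := by
    refine condExp_congr_ae_restrict hB' (hK.integrable _ _) (hK.integrable _ _) ?_
    rw [EventuallyEq, ae_restrict_iff' hBm]
    filter_upwards [hK.compatible (o η) ((o η).max η') η η'] with ω h hω
    have h3 := (ho η).1 ω
    replace hω : η ω = η' ω := hω
    exact h (max_eq_left (hω ▸ h3)).symm hω
  rw [EventuallyEq, ae_restrict_iff' hBm] at h1 h2
  filter_upwards [h1, h2, hK.condExp_le_innerValue ho (τ := (o η).max η')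
    (ae_of_all _ fun ω => le_max_right _ _)] with ω h3 h4 h5 hω
  rw [innerValue, h3 hω, h4 hω]
  exact h5

theorem innerValue_compatible (hK : IsPairReward μ K Z) (ho : IsInnerOptimizer μ K o)
    (η η' : StopTime 𝓕) :
    ∀ᵐ ω ∂μ, η ω = η' ω → innerValue μ K o η ω = innerValue μ K o η' ω := by
  filter_upwards [hK.innerValue_le_of_eq ho η η', hK.innerValue_le_of_eq ho η' η] with ω h1 h2 h
  exact (h1 h).antisymm (h2 h.symm)

/-- The inner value is right continuous in mean along stopping times. -/
theorem tendsto_innerValue (hK : IsPairReward μ K Z) (ho : IsInnerOptimizer μ K o)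
    (hnull : ∀ (S : StopTime 𝓕) (A : Set Ω), μ A = 0 → MeasurableSet[S.sigma] A)
    {σ : ℕ → StopTime 𝓕} {S : StopTime 𝓕} (hσ : SurelyDecreasesTo σ S) :
    Tendsto (fun n => ∫ ω, |innerValue μ K o (σ n) ω - innerValue μ K o S ω| ∂μ) atTop (𝓝 0) := by
  have hmax : (o S).max S = o S := StopTime.ext fun ω => max_eq_left ((ho S).1 ω)
  have hσ' : SurelyDecreasesTo (fun n => (o S).max (σ n)) (o S) := by
    simpa only [hmax] using hσ.max_right (o S)
  have hlevy : Tendsto (fun n => ∫ ω, |(μ[K (o S) S | (σ n).sigma]) ω -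
      (μ[K (o S) S | S.sigma]) ω| ∂μ) atTop (𝓝 0) :=
    tendsto_integral_abs_condExp_sub (fun n => (σ n).sigma_le)
      (fun i j hij => StopTime.sigma_mono fun ω => (hσ ω).1 hij)
      (fun n => StopTime.sigma_mono (hσ.le n)) (fun A hA => hσ.measurableSet_sigma hA)
      (hnull S) (hK.integrable _ _)
  have hl1 := hK.right_snd (fun n => (o S).max (σ n)) σ S hσ
  have hl2 := hK.right_fst (fun _ => S) _ _ hσ'
  have hl3 := hK.right_snd (fun n => o (σ n)) σ S hσ
  have hlim := hl3.add (((hl1.add hl2).add hlevy).const_mul 2)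
  simp only [add_zero, mul_zero] at hlim
  refine squeeze_zero (fun n => integral_nonneg fun ω => abs_nonneg _) (fun n => ?_) hlim
  -- The competitor `o S ∨ σ n` gives an almost sure lower bound close in L¹ to the value at `S`.
  -- The upper bound is needed only in mean: `o (σ n)` is admissible for the problem from `S`.
  set l := μ[K ((o S).max (σ n)) (σ n) | (σ n).sigma]
  have hli : Integrable l μ := integrable_condExp
  have hui := integrable_innerValue μ K o
  have hle : l ≤ᵐ[μ] innerValue μ K o (σ n) :=
    hK.condExp_le_innerValue ho (ae_of_all _ fun ω => le_max_right _ _)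
  have h1 : ∫ ω, |innerValue μ K o (σ n) ω - innerValue μ K o S ω| ∂μ ≤
      (∫ ω, innerValue μ K o (σ n) ω ∂μ - ∫ ω, innerValue μ K o S ω ∂μ) +
        2 * ∫ ω, |l ω - innerValue μ K o S ω| ∂μ :=
    integral_abs_sub_le_of_ae_le (hui _) (hui _) hli hle
  have h2 : ∫ ω, innerValue μ K o (σ n) ω ∂μ - ∫ ω, innerValue μ K o S ω ∂μ ≤
      ∫ ω, |K (o (σ n)) (σ n) ω - K (o (σ n)) S ω| ∂μ := by
    rw [innerValue, innerValue, integral_condExp (StopTime.sigma_le _),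
      integral_condExp (StopTime.sigma_le _)]
    have h3 := integral_le_integral_add_abs_sub (hK.integrable (o (σ n)) (σ n))
      (hK.integrable (o (σ n)) S)
    have h4 := (ho S).2 (o (σ n)) fun ω => (hσ.le n ω).trans ((ho (σ n)).1 ω)
    linarith
  have h3 := integral_abs_sub_le_add hli (integrable_condExp (m := (σ n).sigma) (μ := μ)
    (f := K (o S) S)) (hui S)
  have h4 := integral_abs_condExp_sub_condExp_le (σ n).sigma
    (hK.integrable ((o S).max (σ n)) (σ n)) (hK.integrable (o S) S)
  have h5 := integral_abs_sub_le_add (hK.integrable ((o S).max (σ n)) (σ n))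
    (hK.integrable ((o S).max (σ n)) S) (hK.integrable (o S) S)
  simp only [innerValue] at h1 h2 h3 h4 h5 ⊢
  linarith

end IsPairReward

/-! ### The reduced problem and the double value. -/

/-- The reward of the reduced problem: the maximum of the values of the two inner problems. -/
noncomputable def reducedReward (μ : Measure Ω) (K : StopTime 𝓕 → StopTime 𝓕 → Ω → ℝ)
    (o o' : StopTime 𝓕 → StopTime 𝓕) (η : StopTime 𝓕) (ω : Ω) : ℝ :=
  max (innerValue μ K o η ω) (innerValue μ (fun θ S => K S θ) o' η ω)

theorem integrable_reducedReward (μ : Measure Ω) (K : StopTime 𝓕 → StopTime 𝓕 → Ω → ℝ)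
    (o o' : StopTime 𝓕 → StopTime 𝓕) (η : StopTime 𝓕) : Integrable (reducedReward μ K o o' η) μ :=
  (integrable_innerValue μ K o η).sup (integrable_innerValue μ (fun θ S => K S θ) o' η)

namespace IsPairReward

variable {μ : Measure Ω} {K : StopTime 𝓕 → StopTime 𝓕 → Ω → ℝ} {Z : Ω → ℝ}
  [IsProbabilityMeasure μ] {o o' : StopTime 𝓕 → StopTime 𝓕}

/-- The pair of stopping times built from the optimal stopping times of the two inner problems
attains the reduced reward. -/
theorem exists_pair (hK : IsPairReward μ K Z) (ho : IsInnerOptimizer μ K o)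
    (ho' : IsInnerOptimizer μ (fun θ S => K S θ) o') (η : StopTime 𝓕) :
    ∃ τ₁ τ₂ : StopTime 𝓕, (∀ ω, η ω ≤ τ₁ ω) ∧ (∀ ω, η ω ≤ τ₂ ω) ∧
      (∀ ω, (innerValue μ K o η ω ≤ innerValue μ (fun θ S => K S θ) o' η ω →
        τ₁ ω = η ω ∧ τ₂ ω = o' η ω) ∧
        (innerValue μ (fun θ S => K S θ) o' η ω < innerValue μ K o η ω →
          τ₁ ω = o η ω ∧ τ₂ ω = η ω)) ∧
      reducedReward μ K o o' η =ᵐ[μ] μ[K τ₁ τ₂ | η.sigma] := by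
  let A : Set Ω := {ω | innerValue μ K o η ω ≤ innerValue μ (fun θ S => K S θ) o' η ω}
  have hA : MeasurableSet[η.sigma] A :=
    stronglyMeasurable_condExp.measurableSet_le stronglyMeasurable_condExp
  have hAm := η.sigma_le _ hA
  let τ₁ := StopTime.glue hA (fun ω => le_refl (η ω)) (ho η).1
  let τ₂ := StopTime.glue hA (ho' η).1 (fun ω => le_refl (η ω))
  have h1 : ∀ ω ∈ A, τ₁ ω = η ω ∧ τ₂ ω = o' η ω := fun ω h =>
    ⟨StopTime.glue_of_mem _ _ _ h, StopTime.glue_of_mem _ _ _ h⟩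
  have h2 : ∀ ω ∉ A, τ₁ ω = o η ω ∧ τ₂ ω = η ω := fun ω h =>
    ⟨StopTime.glue_of_notMem _ _ _ h, StopTime.glue_of_notMem _ _ _ h⟩
  refine ⟨τ₁, τ₂, StopTime.le_glue _ _ _, StopTime.le_glue _ _ _,
    fun ω => ⟨h1 ω, fun h => h2 ω (not_le.2 h)⟩, ?_⟩
  have h3 : μ[K τ₁ τ₂ | η.sigma] =ᵐ[μ.restrict A] μ[K η (o' η) | η.sigma] := by
    refine condExp_congr_ae_restrict hA (hK.integrable _ _) (hK.integrable _ _) ?_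
    rw [EventuallyEq, ae_restrict_iff' hAm]
    filter_upwards [hK.compatible τ₁ η τ₂ (o' η)] with ω h hω using h (h1 ω hω).1 (h1 ω hω).2
  have h4 : μ[K τ₁ τ₂ | η.sigma] =ᵐ[μ.restrict Aᶜ] μ[K (o η) η | η.sigma] := by
    refine condExp_congr_ae_restrict hA.compl (hK.integrable _ _) (hK.integrable _ _) ?_
    rw [EventuallyEq, ae_restrict_iff' hAm.compl]
    filter_upwards [hK.compatible τ₁ (o η) τ₂ η] with ω h hω using h (h2 ω hω).1 (h2 ω hω).2
  rw [EventuallyEq, ae_restrict_iff' hAm] at h3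
  rw [EventuallyEq, ae_restrict_iff' hAm.compl] at h4
  filter_upwards [h3, h4] with ω h3 h4
  by_cases hω : ω ∈ A
  · rw [h3 hω]
    exact max_eq_right hω
  · rw [h4 hω]
    exact max_eq_left (not_le.1 hω).le

variable [𝓕.IsRightContinuous]

theorem condExp_le_reducedReward (hK : IsPairReward μ K Z) (ho : IsInnerOptimizer μ K o)
    (ho' : IsInnerOptimizer μ (fun θ S => K S θ) o') (τ₁ τ₂ : StopTime 𝓕) :
    μ[K τ₁ τ₂ | (τ₁.min τ₂).sigma] ≤ᵐ[μ] reducedReward μ K o o' (τ₁.min τ₂) := by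
  have hA := τ₁.measurableSet_min_le τ₂
  have hAm := (τ₁.min τ₂).sigma_le _ hA
  have h1 : μ[K τ₁ τ₂ | (τ₁.min τ₂).sigma] =ᵐ[μ.restrict {ω | τ₁ ω ≤ τ₂ ω}]
      μ[K (τ₁.min τ₂) τ₂ | (τ₁.min τ₂).sigma] := by
    refine condExp_congr_ae_restrict hA (hK.integrable _ _) (hK.integrable _ _) ?_
    rw [EventuallyEq, ae_restrict_iff' hAm]
    filter_upwards [hK.compatible τ₁ (τ₁.min τ₂) τ₂ τ₂] with ω h hω
    exact h (min_eq_left hω).symm rfl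
  have h2 : μ[K τ₁ τ₂ | (τ₁.min τ₂).sigma] =ᵐ[μ.restrict {ω | τ₁ ω ≤ τ₂ ω}ᶜ]
      μ[K τ₁ (τ₁.min τ₂) | (τ₁.min τ₂).sigma] := by
    refine condExp_congr_ae_restrict hA.compl (hK.integrable _ _) (hK.integrable _ _) ?_
    rw [EventuallyEq, ae_restrict_iff' hAm.compl]
    filter_upwards [hK.compatible τ₁ τ₁ τ₂ (τ₁.min τ₂)] with ω h (hω : ¬τ₁ ω ≤ τ₂ ω)
    exact h rfl (min_eq_right (not_le.1 hω).le).symm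
  rw [EventuallyEq, ae_restrict_iff' hAm] at h1
  rw [EventuallyEq, ae_restrict_iff' hAm.compl] at h2
  filter_upwards [h1, h2,
    hK.condExp_le_innerValue ho (η := τ₁.min τ₂) (τ := τ₁) (ae_of_all _ fun ω => min_le_left _ _),
    hK.swap.condExp_le_innerValue ho' (η := τ₁.min τ₂) (τ := τ₂)
      (ae_of_all _ fun ω => min_le_right _ _)] with ω h1 h2 h3 h4
  by_cases hω : τ₁ ω ≤ τ₂ ω
  · rw [h1 hω]
    exact h4.trans (le_max_right _ _)
  · rw [h2 hω]
    exact h3.trans (le_max_left _ _)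

/-- The reward does not change much when both stopping times are delayed to a limit from the
left. -/
theorem tendsto_integral_abs_sub_max (hK : IsPairReward μ K Z) {ρ τ₁ τ₂ : ℕ → StopTime 𝓕}
    {θ : StopTime 𝓕} (hρ : SurelyIncreasesTo ρ θ) (h₁ : ∀ n ω, ρ n ω ≤ τ₁ n ω)
    (h₂ : ∀ n ω, ρ n ω ≤ τ₂ n ω) :
    Tendsto (fun n => ∫ ω, |K (τ₁ n) (τ₂ n) ω - K ((τ₁ n).max θ) ((τ₂ n).max θ) ω| ∂μ)
      atTop (𝓝 0) := by
  -- The two times are delayed one after the other. Delaying `τ` to `τ ∨ θ` changes the reward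
  -- exactly as moving `τ ∧ θ` to `θ` does.
  have hlim := (hK.swap.left_snd_of_squeezed (η := τ₂) (σ := fun n => (τ₁ n).min θ) hρ
    (fun n ω => le_min (h₁ n ω) (hρ.le n ω)) (fun n ω => min_le_right _ _)).add
    (hK.left_snd_of_squeezed (η := fun n => (τ₁ n).max θ) (σ := fun n => (τ₂ n).min θ) hρ
    (fun n ω => le_min (h₂ n ω) (hρ.le n ω)) (fun n ω => min_le_right _ _))
  rw [add_zero] at hlim
  refine squeeze_zero (fun n => integral_nonneg fun ω => abs_nonneg _) (fun n => ?_) hlim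
  refine (integral_abs_sub_le_add (hK.integrable _ _) (hK.integrable ((τ₁ n).max θ) (τ₂ n))
    (hK.integrable _ _)).trans (add_le_add (le_of_eq ?_) (le_of_eq ?_))
  · refine integral_congr_ae ?_
    filter_upwards [hK.compatible (τ₁ n) ((τ₁ n).min θ) (τ₂ n) (τ₂ n),
      hK.compatible ((τ₁ n).max θ) θ (τ₂ n) (τ₂ n),
      hK.compatible (τ₁ n) ((τ₁ n).max θ) (τ₂ n) (τ₂ n),
      hK.compatible ((τ₁ n).min θ) θ (τ₂ n) (τ₂ n)] with ω h1 h2 h3 h4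
    rcases le_total (τ₁ n ω) (θ ω) with h | h
    · rw [h1 (min_eq_left h).symm rfl, h2 (max_eq_right h) rfl]
    · rw [h3 (max_eq_left h).symm rfl, h4 (min_eq_right h) rfl, sub_self, sub_self]
  · refine integral_congr_ae ?_
    filter_upwards [hK.compatible ((τ₁ n).max θ) ((τ₁ n).max θ) (τ₂ n) ((τ₂ n).min θ),
      hK.compatible ((τ₁ n).max θ) ((τ₁ n).max θ) ((τ₂ n).max θ) θ,
      hK.compatible ((τ₁ n).max θ) ((τ₁ n).max θ) (τ₂ n) ((τ₂ n).max θ),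
      hK.compatible ((τ₁ n).max θ) ((τ₁ n).max θ) ((τ₂ n).min θ) θ] with ω h1 h2 h3 h4
    rcases le_total (τ₂ n ω) (θ ω) with h | h
    · rw [h1 rfl (min_eq_left h).symm, h2 rfl (max_eq_right h)]
    · rw [h3 rfl (max_eq_left h).symm, h4 rfl (min_eq_right h), sub_self, sub_self]

theorem integral_le_integral_reducedReward (hK : IsPairReward μ K Z) (ho : IsInnerOptimizer μ K o)
    (ho' : IsInnerOptimizer μ (fun θ S => K S θ) o') (τ₁ τ₂ : StopTime 𝓕) :
    ∫ ω, K τ₁ τ₂ ω ∂μ ≤ ∫ ω, reducedReward μ K o o' (τ₁.min τ₂) ω ∂μ := by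
  rw [← integral_condExp (τ₁.min τ₂).sigma_le]
  exact integral_mono_ae integrable_condExp (integrable_reducedReward μ K o o' _)
    (hK.condExp_le_reducedReward ho ho' τ₁ τ₂)

theorem isReward_reducedReward (hK : IsPairReward μ K Z) (ho : IsInnerOptimizer μ K o)
    (ho' : IsInnerOptimizer μ (fun θ S => K S θ) o')
    (hnull : ∀ (S : StopTime 𝓕) (A : Set Ω), μ A = 0 → MeasurableSet[S.sigma] A) :
    IsReward μ (reducedReward μ K o o') where
  integrable := integrable_reducedReward μ K o o'
  compatible τ τ' := by
    filter_upwards [hK.innerValue_compatible ho τ τ', hK.swap.innerValue_compatible ho' τ τ']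
      with ω h1 h2 h
    simp only [reducedReward, h1 h, h2 h]
  bounded := by
    refine ⟨∫ ω, Z ω ∂μ, fun η => ?_⟩
    obtain ⟨τ₁, τ₂, -, -, -, h⟩ := hK.exists_pair ho ho' η
    rw [integral_congr_ae h, integral_condExp η.sigma_le]
    refine integral_mono_ae (hK.integrable _ _) hK.integrable_bound ?_
    filter_upwards [hK.bound τ₁ τ₂] with ω h using (le_abs_self _).trans h
  right_usc σ S hσ c hc := by
    have hu := integrable_innerValue μ K o
    have hφ := integrable_reducedReward μ K o o'
    have hu' := integrable_innerValue μ (fun θ S => K S θ) o'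
    have hlim := (tendsto_const_nhds (x := ∫ ω, reducedReward μ K o o' S ω ∂μ)).add
      ((hK.tendsto_innerValue ho hnull hσ).add (hK.swap.tendsto_innerValue ho' hnull hσ))
    rw [add_zero, add_zero] at hlim
    refine ge_of_tendsto' hlim fun n => (hc n).trans ?_
    refine (integral_le_integral_add_abs_sub (hφ (σ n))
      (hφ S)).trans ?_
    gcongr 1
    refine le_trans ?_ (integral_add ((hu (σ n)).sub (hu S)).abs
      ((hu' (σ n)).sub (hu' S)).abs).le
    refine integral_mono ((hφ (σ n)).sub (hφ S)).abs
      (((hu (σ n)).sub (hu S)).abs.add ((hu' (σ n)).sub (hu' S)).abs) fun ω => ?_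
    exact (abs_max_sub_max_le_max _ _ _ _).trans
      (max_le_add_of_nonneg (abs_nonneg _) (abs_nonneg _))
  left_usc ρ σ θ hρ hρσ hσ c hc := by
    choose τ₁ τ₂ h₁ h₂ hpair hval using fun n => hK.exists_pair ho ho' (σ n)
    have hlim := (tendsto_const_nhds (x := ∫ ω, reducedReward μ K o o' θ ω ∂μ)).add
      (hK.tendsto_integral_abs_sub_max (τ₁ := τ₁) (τ₂ := τ₂) hρ
        (fun n ω => (hρσ n ω).trans (h₁ n ω)) (fun n ω => (hρσ n ω).trans (h₂ n ω)))
    rw [add_zero] at hlim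
    refine ge_of_tendsto' hlim fun n => (hc n).trans ?_
    -- One member of the pair equals `σ n`, hence is at most `θ`, so its delayed version is `θ`. The
    -- delayed pair is then bounded in mean by the reduced reward at `θ`.
    have hmin : ((τ₁ n).max θ).min ((τ₂ n).max θ) = θ := by
      refine StopTime.ext fun ω => ?_
      refine le_antisymm ?_ (le_min (le_max_right _ _) (le_max_right _ _))
      rcases le_or_gt (innerValue μ K o (σ n) ω)
        (innerValue μ (fun θ S => K S θ) o' (σ n) ω) with h | h
      · refine (min_le_left _ _).trans (max_le ?_ le_rfl)
        exact ((hpair n ω).1 h).1.trans_le (hσ n ω)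
      · refine (min_le_right _ _).trans (max_le ?_ le_rfl)
        exact ((hpair n ω).2 h).2.trans_le (hσ n ω)
    have h3 := hK.integral_le_integral_reducedReward ho ho' ((τ₁ n).max θ) ((τ₂ n).max θ)
    rw [hmin] at h3
    rw [integral_congr_ae (hval n), integral_condExp (σ n).sigma_le]
    have h4 := integral_le_integral_add_abs_sub (hK.integrable (τ₁ n) (τ₂ n))
      (hK.integrable ((τ₁ n).max θ) ((τ₂ n).max θ))
    linarith

/-- Any pair, first made to follow `S` surely, is bounded through the tower property by the reduced
reward at its minimum, hence by that at `θ`, which the given pair attains. -/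
theorem isDoubleValue_of_max (hK : IsPairReward μ K Z) (ho : IsInnerOptimizer μ K o)
    (ho' : IsInnerOptimizer μ (fun θ S => K S θ) o')
    (hφ : IsReward μ (reducedReward μ K o o')) {S θ τ₁ τ₂ : StopTime 𝓕}
    (hθ : ∀ ω, S ω ≤ θ ω)
    (hmax : ∀ τ : StopTime 𝓕, (∀ ω, S ω ≤ τ ω) →
      ∫ ω, reducedReward μ K o o' τ ω ∂μ ≤ ∫ ω, reducedReward μ K o o' θ ω ∂μ)
    (h₁ : ∀ ω, θ ω ≤ τ₁ ω) (h₂ : ∀ ω, θ ω ≤ τ₂ ω)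
    (hval : reducedReward μ K o o' θ =ᵐ[μ] μ[K τ₁ τ₂ | θ.sigma]) :
    IsDoubleValue μ K S (μ[K τ₁ τ₂ | S.sigma]) := by
  refine ⟨(stronglyMeasurable_condExp.mono S.sigma_le).measurable, ?_, fun g _ hg =>
    hg (⟨τ₁, ae_of_all _ fun ω => (hθ ω).trans (h₁ ω)⟩,
      ⟨τ₂, ae_of_all _ fun ω => (hθ ω).trans (h₂ ω)⟩)⟩
  rintro ⟨⟨σ₁, hσ₁⟩, ⟨σ₂, hσ₂⟩⟩
  have hS : ∀ ω, S ω ≤ (S.max σ₁).min (S.max σ₂) ω := fun ω =>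
    le_min (le_max_left _ _) (le_max_left _ _)
  have h3 : K σ₁ σ₂ =ᵐ[μ] K (S.max σ₁) (S.max σ₂) := by
    filter_upwards [hσ₁, hσ₂, hK.compatible σ₁ (S.max σ₁) σ₂ (S.max σ₂)] with ω h1 h2 h
    exact h (max_eq_right h1).symm (max_eq_right h2).symm
  calc μ[K σ₁ σ₂ | S.sigma] =ᵐ[μ] μ[K (S.max σ₁) (S.max σ₂) | S.sigma] := condExp_congr_ae h3
    _ =ᵐ[μ] μ[μ[K (S.max σ₁) (S.max σ₂) | ((S.max σ₁).min (S.max σ₂)).sigma] | S.sigma] :=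
      (condExp_condExp_of_le (StopTime.sigma_mono hS) (StopTime.sigma_le _)).symm
    _ ≤ᵐ[μ] μ[reducedReward μ K o o' ((S.max σ₁).min (S.max σ₂)) | S.sigma] :=
      condExp_mono integrable_condExp (hφ.integrable _) (hK.condExp_le_reducedReward ho ho' _ _)
    _ ≤ᵐ[μ] μ[reducedReward μ K o o' θ | S.sigma] :=
      hφ.condExp_le_of_max hθ hmax (ae_of_all _ hS)
    _ =ᵐ[μ] μ[μ[K τ₁ τ₂ | θ.sigma] | S.sigma] := condExp_congr_ae hval
    _ =ᵐ[μ] μ[K τ₁ τ₂ | S.sigma] :=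
      condExp_condExp_of_le (StopTime.sigma_mono hθ) (StopTime.sigma_le _)

end IsPairReward

/-! ### From biadmissible families to pair rewards, and the conclusion. -/

theorem tendsto_integral_abs_of_essSup {μ : Measure Ω} {ι : Type*} {f : ℕ → ι → Ω → ℝ}
    (hf : ∀ n i, AEStronglyMeasurable (f n i) μ) {G : ℕ → Ω → ℝ≥0∞}
    (hG : ∀ n, IsEssSup μ (fun i ω => ENNReal.ofReal |f n i ω|) (G n))
    (hlim : Tendsto (fun n => ∫⁻ ω, G n ω ∂μ) atTop (𝓝 0)) (i : ℕ → ι) :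
    Tendsto (fun n => ∫ ω, |f n (i n) ω| ∂μ) atTop (𝓝 0) := by
  have h1 : Tendsto (fun n => ∫⁻ ω, ENNReal.ofReal |f n (i n) ω| ∂μ) atTop (𝓝 0) :=
    tendsto_of_tendsto_of_tendsto_of_le_of_le tendsto_const_nhds hlim (fun _ => zero_le)
      fun n => lintegral_mono_ae ((hG n).2.1 (i n))
  have h2 := (ENNReal.tendsto_toReal ENNReal.zero_ne_top).comp h1
  rw [ENNReal.toReal_zero] at h2
  refine h2.congr fun n => ?_
  rw [integral_eq_lintegral_of_nonneg_ae (ae_of_all _ fun ω => abs_nonneg _)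
    (continuous_abs.comp_aestronglyMeasurable (hf n (i n)))]
  rfl

theorem IsBiadmissible.isPairReward {μ : Measure Ω} [IsProbabilityMeasure μ]
    {ψ : StopTime 𝓕 → StopTime 𝓕 → Ω → ℝ} (hψ : IsBiadmissible μ ψ)
    (hright : UniformlyRightContinuous μ ψ) (hleft : UniformlyLeftContinuous μ ψ) {p : ℝ}
    (hp : 1 < p) {Z : Ω → ℝ≥0∞}
    (hZ : IsEssSup μ (fun (q : StopTime 𝓕 × StopTime 𝓕) ω => ENNReal.ofReal (ψ q.1 q.2 ω ^ p)) Z)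
    (hZint : ∫⁻ ω, Z ω ∂μ < ∞) : IsPairReward μ ψ fun ω => 1 + (Z ω).toReal := by
  have hmeas : ∀ θ S, AEStronglyMeasurable (ψ θ S) μ := fun θ S =>
    ((hψ.measurable θ S).mono (θ.max S).sigma_le le_rfl).aestronglyMeasurable
  have hsnd : ∀ (η σ : ℕ → StopTime 𝓕) (S : StopTime 𝓕), UniformlyConvergesAlong μ ψ σ S →
      Tendsto (fun n => ∫ ω, |ψ (η n) (σ n) ω - ψ (η n) S ω| ∂μ) atTop (𝓝 0) := by
    rintro η σ S ⟨⟨G, hG, hlim⟩, -⟩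
    have := tendsto_integral_abs_of_essSup
      (f := fun n θ ω => ψ θ S ω - ψ θ (σ n) ω) (fun n θ => (hmeas _ _).sub (hmeas _ _)) hG hlim η
    simpa only [abs_sub_comm] using this
  have hfst : ∀ (η σ : ℕ → StopTime 𝓕) (S : StopTime 𝓕), UniformlyConvergesAlong μ ψ σ S →
      Tendsto (fun n => ∫ ω, |ψ (σ n) (η n) ω - ψ S (η n) ω| ∂μ) atTop (𝓝 0) := by
    rintro η σ S ⟨-, G, hG, hlim⟩
    have := tendsto_integral_abs_of_essSup
      (f := fun n θ ω => ψ S θ ω - ψ (σ n) θ ω) (fun n θ => (hmeas _ _).sub (hmeas _ _)) hG hlim η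
    simpa only [abs_sub_comm] using this
  refine ⟨(integrable_const 1).add (integrable_toReal_of_lintegral_ne_top hZ.1.aemeasurable
    hZint.ne), fun θ S => ?_, hmeas, hψ.compatible,
    fun η σ S h => hsnd η σ S (hright S σ (ae_of_all _ h)),
    fun η σ S h => hsnd η σ S (hleft S σ (ae_of_all _ h)),
    fun η σ S h => hfst η σ S (hright S σ (ae_of_all _ h)),
    fun η σ S h => hfst η σ S (hleft S σ (ae_of_all _ h))⟩
  filter_upwards [hψ.nonneg θ S, hZ.2.1 (θ, S), ae_lt_top hZ.1 hZint.ne] with ω h0 h1 h2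
  rw [abs_of_nonneg h0]
  have h3 : ψ θ S ω ^ p ≤ (Z ω).toReal := (ENNReal.ofReal_le_iff_le_toReal h2.ne).1 h1
  have h4 : 0 ≤ ψ θ S ω ^ p := Real.rpow_nonneg h0 p
  -- The integrable bound comes from `x ≤ 1 + x ^ p` for `x ≥ 0`.
  rcases le_total (ψ θ S ω) 1 with h | h
  · linarith
  · have := Real.self_le_rpow_of_one_le h hp.le
    linarith

end DoubleStopping

theorem theorem2p3 {Ω : Type*} {m : MeasurableSpace Ω} (μ : Measure Ω) [IsProbabilityMeasure μ]
    {T : ℝ} (hT : 0 ≤ T) (𝓕 : Filtration (Set.Icc (0 : ℝ) T) m)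
    (h𝓕 : DoubleStopping.IsStandardFiltration μ hT 𝓕)
    (ψ : DoubleStopping.StopTime 𝓕 → DoubleStopping.StopTime 𝓕 → Ω → ℝ)
    (hψ : DoubleStopping.IsBiadmissible μ ψ)
    (hright : DoubleStopping.UniformlyRightContinuous μ ψ)
    (hleft : DoubleStopping.UniformlyLeftContinuous μ ψ)
    (hp : ∃ p : ℝ, 1 < p ∧ ∃ Z : Ω → ℝ≥0∞,
      DoubleStopping.IsEssSup μ
        (fun (q : DoubleStopping.StopTime 𝓕 × DoubleStopping.StopTime 𝓕) ω =>
          ENNReal.ofReal (ψ q.1 q.2 ω ^ p)) Z ∧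
      ∫⁻ ω, Z ω ∂μ < ∞)
    (S : DoubleStopping.StopTime 𝓕) :
    ∃ (u₁ u₂ : DoubleStopping.StopTime 𝓕 → Ω → ℝ) (v : Ω → ℝ)
      (θ θ₁ θ₂ τ₁ τ₂ : DoubleStopping.StopTime 𝓕),
      -- the value families of the two inner problems
      (∀ η, DoubleStopping.IsSingleValue μ (fun τ => ψ τ η) η (u₁ η)) ∧
      (∀ η, DoubleStopping.IsSingleValue μ (fun τ => ψ η τ) η (u₂ η)) ∧
      -- optimal stopping times for the reduced problem and for the two inner problems
      DoubleStopping.IsOptimal μ (fun η ω => max (u₁ η ω) (u₂ η ω)) S θ ∧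
      DoubleStopping.IsOptimal μ (fun τ => ψ τ θ) θ θ₁ ∧
      DoubleStopping.IsOptimal μ (fun τ => ψ θ τ) θ θ₂ ∧
      -- the pair built from them
      (∀ᵐ ω ∂μ, (u₁ θ ω ≤ u₂ θ ω → τ₁ ω = θ ω ∧ τ₂ ω = θ₂ ω) ∧
        (u₂ θ ω < u₁ θ ω → τ₁ ω = θ₁ ω ∧ τ₂ ω = θ ω)) ∧
      -- the pair attains the double stopping value
      (∀ᵐ ω ∂μ, S ω ≤ τ₁ ω) ∧ (∀ᵐ ω ∂μ, S ω ≤ τ₂ ω) ∧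
      DoubleStopping.IsDoubleValue μ ψ S v ∧
      v =ᵐ[μ] μ[ψ τ₁ τ₂ | S.sigma] := by
  obtain ⟨p, hp, Z, hZ, hZint⟩ := hp
  have := h𝓕.right_continuous
  have hK := hψ.isPairReward hright hleft hp hZ hZint
  obtain ⟨o, ho⟩ := hK.exists_isInnerOptimizer
  obtain ⟨o', ho'⟩ := hK.swap.exists_isInnerOptimizer
  have hφ := hK.isReward_reducedReward ho ho' fun S A => h𝓕.measurableSet_sigma_of_null S
  obtain ⟨θ, hθ, hmax⟩ := hφ.exists_max S
  obtain ⟨τ₁, τ₂, h₁, h₂, hpair, hval⟩ := hK.exists_pair ho ho' θ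
  exact ⟨DoubleStopping.innerValue μ ψ o, DoubleStopping.innerValue μ (fun θ S => ψ S θ) o', _,
    θ, o θ, o' θ, τ₁, τ₂,
    fun η => (hK.isReward η).isSingleValue_of_max (ho η).1 (ho η).2,
    fun η => (hK.swap.isReward η).isSingleValue_of_max (ho' η).1 (ho' η).2,
    hφ.isOptimal_of_max hθ hmax,
    (hK.isReward θ).isOptimal_of_max (ho θ).1 (ho θ).2,
    (hK.swap.isReward θ).isOptimal_of_max (ho' θ).1 (ho' θ).2,
    ae_of_all _ hpair,
    ae_of_all _ fun ω => (hθ ω).trans (h₁ ω), ae_of_all _ fun ω => (hθ ω).trans (h₂ ω),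
    hK.isDoubleValue_of_max ho ho' hφ hθ hmax h₁ h₂ hval,
    EventuallyEq.rfl⟩
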